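/- **Theorem (convergence rate of online Sinkhorn).** Let $\mathcal X\subset\mathbb R^d$ be compact, $\alpha,\beta$ Borel probability measures on $\mathcal X$, $C:\mathcal X\times\mathcal X\to\mathbb R$ Lipschitz and $\varepsilon>0$. Let $(f^*,g^*)$ be a pair of optimal potentials: a pair of continuous functions on $\mathcal X$ maximising $$\int f\,d\alpha+\int g\,d\beta-\varepsilon\int e^{(f(x)+g(y)-C(x,y))/\varepsilon}\,d\alpha(x)\,d\beta(y)$$ over all pairs of continuous functions, in the version with $f^*(x)=-\varepsilon\log\int e^{(g^*(y)-C(x,y))/\varepsilon}d\beta(y)$ and $g^*(y)=-\varepsilon\log\int e^{(f^*(x)-C(x,y))/\varepsilon}d\alpha(x)$ for all $x,y\in\mathcal X$. Let $-1<b<-\tfrac12$ and $a-b>1$, and for $t\ge1$ let $\eta_t=t^b$ and let $b_t=t^{2a}$, rounded (up or down) to a neighbouring integer. Online Sinkhorn uses independent samples $x_i\sim\alpha$, $y_i\sim\beta$, $i=1,2,\dots$ (all of them mutually independent). It starts from $n_0\ge1$ samples and $$e^{-f_0/\varepsilon}=\sum_{i\le n_0}e^{-C(\cdot,y_i)/\varepsilon},\qquad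 e^{-g_0/\varepsilon}=\sum_{i\le n_0}e^{-C(x_i,\cdot)/\varepsilon}.$$ Iteration $t\ge1$ draws the $b_t$ new samples with indices $n_{t-1}<i\le n_t:=n_{t-1}+b_t$ and sets $$e^{-f_t/\varepsilon}=(1-\eta_t)e^{-f_{t-1}/\varepsilon}+\frac{\eta_t}{b_t}\sum_{n_{t-1}<i\le n_t}e^{(g_{t-1}(y_i)-C(\cdot,y_i))/\varepsilon},$$ $$e^{-g_t/\varepsilon}=(1-\eta_t)e^{-g_{t-1}/\varepsilon}+\frac{\eta_t}{b_t}\sum_{n_{t-1}<i\le n_t}e^{(f_t(x_i)-C(x_i,\cdot))/\varepsilon}.$$ For an integer $N\ge1$ let $t(N)$ be the first $t$ with $\sum_{i=1}^t b_i>N$, let $\|h\|_{var}=\sup_{\mathcal X}h-\inf_{\mathcal X}h$, and let $$\delta_N=\mathbb E\Big[\big\|(f_{t(N)}-f^*)/\varepsilon\big\|_{var}+\big\|(g_{t(N)}-g^*)/\varepsilon\big\|_{var}\Big].$$ Then this random error is integrable, and there are constants $c,K>0$, depending only on $\mathcal X,\alpha,\beta,C,\varepsilon,f^*,g^*,a,b$,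 such that for all $N\ge1$ $$\delta_N\le K\Big(\exp\big(-cN^{\frac{b+1}{2a+1}}\big)+N^{-\frac a{2a+1}}\Big),$$ where the right-hand side is $O\big(N^{-\frac a{2a+1}}\big)$ as $N\to\infty$; hence $\delta_N=O\big(N^{-\frac a{2a+1}}\big)$. -/

import Mathlib

open MeasureTheory ProbabilityTheory Filter
open scoped NNReal Topology

noncomputable section

namespace OnlineSinkhorn

/-- The variation (oscillation) norm `sup h - inf h`. -/
def varNorm {E : Type*} (h : E → ℝ) : ℝ :=
  (⨆ z, h z) - ⨅ z, h z

/-- The dual objective of entropic optimal transport,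
`∫ f dα + ∫ g dβ - ε ∫ exp ((f ⊕ g - C) / ε) d(α ⊗ β)`. -/
def dualObjective {E : Type*} [MeasurableSpace E] (ε : ℝ) (C : E → E → ℝ)
    (α β : Measure E) (f g : E → ℝ) : ℝ :=
  (∫ x, f x ∂α) + (∫ y, g y ∂β)
    - ε * ∫ z : E × E, Real.exp ((f z.1 + g z.2 - C z.1 z.2) / ε) ∂(α.prod β)

/-- The soft `C`-transform `T_μ (h) = -ε log ∫ exp ((h y - C(·, y)) / ε) dμ(y)`. -/
def softTransform {E : Type*} [MeasurableSpace E] (ε : ℝ) (C : E → E → ℝ)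
    (μ : Measure E) (h : E → ℝ) (x : E) : ℝ :=
  -ε * Real.log (∫ y, Real.exp ((h y - C x y) / ε) ∂μ)

/-- `(f, g)` is a pair of optimal potentials: continuous functions that maximise the dual objective
over all pairs of continuous functions and are the soft `C`-transforms of each other at every point.
A maximiser satisfies the two equations `α`-a.e. and `β`-a.e.; asking for them at every
point selects its canonical version off the supports of `α` and `β`, which the
dual objective does not see. -/
structure IsOptimalPair {E : Type*} [TopologicalSpace E] [MeasurableSpace E] (ε : ℝ)
    (C : E → E → ℝ) (α β : Measure E) (f g : C(E, ℝ)) : Prop where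
  isMax : ∀ f' g' : C(E, ℝ), dualObjective ε C α β f' g' ≤ dualObjective ε C α β f g
  eq_left : ∀ x, f x = softTransform ε C β g x
  eq_right : ∀ y, g y = softTransform ε (fun y x => C x y) α f y

/-- The number of samples (from each of `α`, `β`) available after `t` iterations: `n₀` initial ones
and a batch of size `B i` in each iteration `i = 1, …, t`. -/
def sampleCount (n₀ : ℕ) (B : ℕ → ℕ) (t : ℕ) : ℕ :=
  n₀ + ∑ i ∈ Finset.Icc 1 t, B i

/-- The potential `-ε log ∑_{i < n} w i * exp (-(C · (z i)) / ε)` carried by the points `z i` with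
the (exponentiated) weights `w i`. -/
def weightedPotential {E : Type*} (ε : ℝ) (C : E → E → ℝ) (n : ℕ) (w : ℕ → ℝ) (z : ℕ → E)
    (x : E) : ℝ :=
  -ε * Real.log (∑ i ∈ Finset.range n, w i * Real.exp (-C x (z i) / ε))

/-- The memory of the algorithm: the exponentiated weights `q i = exp (q_i / ε)` at the points `y i`
and `p i = exp (p_i / ε)` at the points `x i`. -/
@[ext] structure Weights where
  q : ℕ → ℝ
  p : ℕ → ℝ

/-- One weight update: of the `n` old weights and `m` new points with indices `n ≤ i < n + m`, the
old weights are multiplied by `1 - η`, and the new point `i` gets the weight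
`(η / m) * exp (h i / ε)`, where `h i` is the value there of the opposite potential. -/
def updateWeights (ε η : ℝ) (n m : ℕ) (w : ℕ → ℝ) (h : ℕ → ℝ) (i : ℕ) : ℝ :=
  if i < n then (1 - η) * w i
  else if i < n + m then η / m * Real.exp (h i / ε)
  else 0

/-- The weights after `t` iterations of online Sinkhorn, run on the sample streams `x` (from `α`)
and `y` (from `β`). Iteration `t + 1` uses the step size `η (t + 1)` and the batch of
points with indices `n_t ≤ i < n_{t+1}`, whose size is `B (t + 1)`. -/
def weights {E : Type*} (ε : ℝ) (C : E → E → ℝ) (η : ℕ → ℝ) (n₀ : ℕ) (B : ℕ → ℕ)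
    (x y : ℕ → E) : ℕ → Weights
  | 0 => ⟨fun i => if i < n₀ then 1 else 0, fun i => if i < n₀ then 1 else 0⟩
  | t + 1 =>
    let w := weights ε C η n₀ B x y t
    let n := sampleCount n₀ B t
    let m := B (t + 1)
    let g : E → ℝ := weightedPotential ε (fun y x => C x y) n w.p x
    let q' : ℕ → ℝ := updateWeights ε (η (t + 1)) n m w.q (fun i => g (y i))
    let f' : E → ℝ := weightedPotential ε C (n + m) q' y
    let p' : ℕ → ℝ := updateWeights ε (η (t + 1)) n m w.p (fun i => f' (x i))
    ⟨q', p'⟩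

/-- The first potential `f_t` after `t` iterations. -/
def potentialF {E : Type*} (ε : ℝ) (C : E → E → ℝ) (η : ℕ → ℝ) (n₀ : ℕ) (B : ℕ → ℕ)
    (x y : ℕ → E) (t : ℕ) : E → ℝ :=
  weightedPotential ε C (sampleCount n₀ B t) (weights ε C η n₀ B x y t).q y

/-- The second potential `g_t` after `t` iterations. -/
def potentialG {E : Type*} (ε : ℝ) (C : E → E → ℝ) (η : ℕ → ℝ) (n₀ : ℕ) (B : ℕ → ℕ)
    (x y : ℕ → E) (t : ℕ) : E → ℝ :=
  weightedPotential ε (fun y x => C x y) (sampleCount n₀ B t) (weights ε C η n₀ B x y t).p x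

/-- The error `‖(f_t - f) / ε‖_var + ‖(g_t - g) / ε‖_var` of the iterates with respect to `(f, g)`. -/
def potentialError {E : Type*} (ε : ℝ) (C : E → E → ℝ) (η : ℕ → ℝ) (n₀ : ℕ) (B : ℕ → ℕ)
    (f g : E → ℝ) (x y : ℕ → E) (t : ℕ) : ℝ :=
  varNorm (fun z => (potentialF ε C η n₀ B x y t z - f z) / ε)
    + varNorm (fun z => (potentialG ε C η n₀ B x y t z - g z) / ε)

/-- The first iteration number `t` for which `B 1 + ⋯ + B t > N`. -/
def iterationOf (B : ℕ → ℕ) (N : ℕ) : ℕ :=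
  sInf {t : ℕ | N < ∑ i ∈ Finset.Icc 1 t, B i}

end OnlineSinkhorn

end

/-! Write `k = exp (-C / ε)`, `u = exp (-f_t / ε)`, `v = exp (-g_t / ε)`, and `w`, `w'` for the same
scalings of the optimal potentials. The error is measured by the least `θ` for which all ratios of
values of `u / w` and of `v / w'` are at most `1 + θ`; the variation norm of `log (u / w)` is then
at most `θ`. Unlike the logarithmic Hilbert metric, this quantity passes linearly through convex
combinations and through expectations.

Relative to the fixed point, the exact Sinkhorn update is `∫ k / (w w') · (w' / v) dβ`, a Markov
average of `w' / v` with density bounded below, so it multiplies `θ` by `1 - δ`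
(`RatioLE.integral_markov`). Mixing with step size `η` leaves a factor `1 - c η`
(`RatioLE.convexComb`, `RatioLE.halfStep`).

Replacing the integral by a batch average costs an error uniform in the free variable. Given the
past it is the supremum of a centred Lipschitz process with subgaussian increments. A compact subset
of a Euclidean space has geometrically growing covering numbers, so chaining bounds its expectation
by a multiple of `m ^ (-1/2)` for a batch of size `m` (`exists_uniform_deviation_bound`).

Hence `E θ_t ≤ (1 - c t ^ b) E θ_{t-1} + D t ^ (b - a)` (`exists_ratio_bound`), which is dominated
by a multiple of `(t + s) ^ (-a)` for a suitable shift `s` (`exists_supersolution`). Since `N` is at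
most of order `t(N) ^ (2a + 1)`, the rate in `N` follows (`iterationOf_rpow_le`). -/

noncomputable section

namespace OnlineSinkhorn

/-! ### Ratio bounds for positive functions and their contraction. -/

variable {E : Type*}

/-- All ratios of values of `h` are at most `r`. -/
def RatioLE (h : E → ℝ) (r : ℝ) : Prop := ∀ z z', h z ≤ r * h z'

lemma RatioLE.mono {h : E → ℝ} {r r' : ℝ} (H : RatioLE h r) (h0 : ∀ z, 0 ≤ h z) (hr : r ≤ r') :
    RatioLE h r' := fun z z' => (H z z').trans (mul_le_mul_of_nonneg_right hr (h0 z'))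

lemma RatioLE.add {h h' : E → ℝ} {r : ℝ} (H : RatioLE h r) (H' : RatioLE h' r) :
    RatioLE (fun z => h z + h' z) r := fun z z' => by
  have := H z z'
  have := H' z z'
  linarith

lemma RatioLE.const_mul {h : E → ℝ} {r c : ℝ} (H : RatioLE h r) (hc : 0 ≤ c) :
    RatioLE (fun z => c * h z) r := fun z z' => by
  have := mul_le_mul_of_nonneg_left (H z z') hc
  linarith

lemma RatioLE.sum {ι : Type*} {s : Finset ι} {h : ι → E → ℝ} {r : ℝ}
    (H : ∀ i ∈ s, RatioLE (h i) r) : RatioLE (fun z => ∑ i ∈ s, h i z) r := fun z z' => by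
  rw [Finset.mul_sum]
  exact Finset.sum_le_sum fun i hi => H i hi z z'

lemma RatioLE.div_const {h : E → ℝ} {r c : ℝ} (H : RatioLE h r) (hc : 0 ≤ c) :
    RatioLE (fun z => h z / c) r := by
  have := H.const_mul (inv_nonneg.2 hc)
  simpa [div_eq_inv_mul] using this

lemma RatioLE.div {h h' : E → ℝ} {r r' : ℝ} (H : RatioLE h r) (H' : RatioLE h' r')
    (h0 : ∀ z, 0 < h z) (h0' : ∀ z, 0 < h' z) : RatioLE (fun z => h z / h' z) (r * r') :=
  fun z z' => by
    have h1 := H z z'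
    have h2 := H' z' z
    dsimp only
    rw [div_le_iff₀ (h0' z),
      show r * r' * (h z' / h' z') * h' z = (r * h z') * (r' * h' z) / h' z' by ring,
      le_div_iff₀ (h0' z')]
    have h3 : 0 < r * h z' := (h0 z).trans_le h1
    exact mul_le_mul h1 h2 (h0' z').le h3.le

lemma varNorm_nonneg_of_bounded [Nonempty E] {h : E → ℝ} (hA : BddAbove (Set.range h))
    (hB : BddBelow (Set.range h)) : 0 ≤ varNorm h := by
  obtain ⟨z⟩ := ‹Nonempty E›
  have h1 := le_ciSup hA z
  have h2 := ciInf_le hB z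
  unfold varNorm
  linarith

lemma varNorm_le_of_forall_sub_le [Nonempty E] {h : E → ℝ} {r : ℝ}
    (H : ∀ z z', h z - h z' ≤ r) : varNorm h ≤ r := by
  unfold varNorm
  rw [sub_le_iff_le_add]
  refine ciSup_le fun z => ?_
  rw [← sub_le_iff_le_add']
  exact le_ciInf fun z' => by linarith [H z z']

/-- The variation norm of the logarithm is controlled by the ratios. -/
lemma RatioLE.varNorm_log_le [Nonempty E] {h : E → ℝ} {θ : ℝ} (H : RatioLE h (1 + θ))
    (h0 : ∀ z, 0 < h z) (hθ : 0 ≤ θ) : varNorm (fun z => -Real.log (h z)) ≤ θ := by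
  refine varNorm_le_of_forall_sub_le fun z z' => ?_
  have h1 : Real.log (h z') ≤ Real.log ((1 + θ) * h z) := Real.log_le_log (h0 z') (H z' z)
  rw [Real.log_mul (by positivity) (h0 z).ne'] at h1
  have h2 := Real.log_le_sub_one_of_pos (show 0 < 1 + θ by positivity)
  linarith

/-- A Markov kernel whose density is at least `δ` contracts ratios. -/
lemma RatioLE.integral_markov [Nonempty E] {F : Type*} [MeasurableSpace F] [Nonempty F]
    {μ : Measure F} [IsProbabilityMeasure μ] {k : E → F → ℝ} {H : F → ℝ} {δ θ : ℝ}
    (hk : ∀ x y, δ ≤ k x y) (hki : ∀ x, Integrable (k x) μ) (hk1 : ∀ x, ∫ y, k x y ∂μ = 1)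
    (hH0 : ∀ y, 0 < H y) (hH : RatioLE H (1 + θ)) (hθ : 0 ≤ θ) (hδ : 0 ≤ δ)
    (hHi : Integrable H μ)
    (hkH : ∀ x, Integrable (fun y => k x y * H y) μ) :
    RatioLE (fun x => ∫ y, k x y * H y ∂μ) (1 + (1 - δ) * θ) := by
  intro x x'
  -- The part `δ ∫ H` of `∫ k x H` does not depend on `x`. The rest integrates `H`, with values in
  -- `[m, (1 + θ) m]`, against a density of mass `1 - δ`. So two values differ by at most `(1 - δ) θ
  -- m`, and each of them is at least `m`.
  set m : ℝ := ⨅ y, H y with hm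
  have hB : BddBelow (Set.range H) := ⟨0, by rintro _ ⟨y, rfl⟩; exact (hH0 y).le⟩
  have hmle : ∀ y, m ≤ H y := fun y => ciInf_le hB y
  have hm0 : 0 ≤ m := le_ciInf fun y => (hH0 y).le
  have hle : ∀ y, H y ≤ (1 + θ) * m := fun y => by
    rw [← div_le_iff₀' (by positivity)]
    exact le_ciInf fun y' => by
      rw [div_le_iff₀' (by positivity)]
      exact hH y y'
  have hδ1 : δ ≤ 1 := by
    have := integral_mono (integrable_const δ) (hki x) (fun y => hk x y)
    simpa [hk1] using this
  have e1 : ∀ x, Integrable (fun y => k x y * H y - δ * H y) μ :=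
    fun x => (hkH x).sub (hHi.const_mul δ)
  have e2 : ∀ x c, Integrable (fun y => (k x y - δ) * c) μ :=
    fun x c => ((hki x).sub (integrable_const δ)).mul_const c
  have e3 : ∀ x c, ∫ y, (k x y - δ) * c ∂μ = (1 - δ) * c := fun x c => by
    rw [integral_mul_const, integral_sub (hki x) (integrable_const δ), hk1]
    simp
  have e4 : ∀ x, ∫ y, (k x y * H y - δ * H y) ∂μ = (∫ y, k x y * H y ∂μ) - δ * ∫ y, H y ∂μ :=
    fun x => by rw [integral_sub (hkH x) (hHi.const_mul δ), integral_const_mul]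
  have up : (∫ y, k x y * H y ∂μ) - δ * ∫ y, H y ∂μ ≤ (1 - δ) * ((1 + θ) * m) := by
    rw [← e4, ← e3 x]
    refine integral_mono (e1 x) (e2 x _) fun y => ?_
    have := mul_le_mul_of_nonneg_left (hle y) (sub_nonneg.2 (hk x y))
    dsimp only
    linarith
  have low : (1 - δ) * m ≤ (∫ y, k x' y * H y ∂μ) - δ * ∫ y, H y ∂μ := by
    rw [← e4, ← e3 x']
    refine integral_mono (e2 x' _) (e1 x') fun y => ?_
    have := mul_le_mul_of_nonneg_left (hmle y) (sub_nonneg.2 (hk x' y))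
    dsimp only
    linarith
  have hJ : m ≤ ∫ y, H y ∂μ := by
    have := integral_mono (integrable_const m) hHi (fun y => hmle y)
    simpa using this
  have h1 : m ≤ ∫ y, k x' y * H y ∂μ := by nlinarith
  have h2 := mul_le_mul_of_nonneg_left h1 (mul_nonneg (sub_nonneg.2 hδ1) hθ)
  nlinarith

/-- Ratios of an approximation `A` of `Abar`, relative to a reference function `w`. -/
lemma RatioLE.of_abs_sub_le {A Abar w : E → ℝ} {R σ φ : ℝ} (hw : ∀ z, 0 < w z)
    (hwr : RatioLE w R) (hR : 1 ≤ R) (hσ : 0 ≤ σ)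
    (hA : ∀ z, R⁻¹ ≤ A z ∧ A z ≤ R) (hAbar : ∀ z, R⁻¹ ≤ Abar z ∧ Abar z ≤ R)
    (hsub : ∀ z, |A z - Abar z| ≤ σ)
    (H : RatioLE (fun z => Abar z / w z) (1 + φ)) :
    RatioLE (fun z => A z / w z) (1 + (φ + 2 * R ^ 4 * σ)) := by
  intro z z'
  have hR0 : 0 < R := by linarith
  have hRi : 0 < R⁻¹ := by positivity
  have hA0 : ∀ z, 0 < A z := fun z => hRi.trans_le (hA z).1
  have hB0 : ∀ z, 0 < Abar z := fun z => hRi.trans_le (hAbar z).1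
  -- The cross products `A z * Abar z'` and `Abar z * A z'` differ by at most `2 R σ`, which `1 ≤ R
  -- ^ 2 * (A z' * Abar z')` turns into a relative error. The fourth factor `R` comes from the
  -- ratios of `w`.
  have h1 : A z ≤ A z' * (Abar z / Abar z') + A z' * (2 * R ^ 3 * σ) := by
    have s1 := (abs_le.1 (hsub z)).2
    have s2 := (abs_le.1 (hsub z')).1
    have k1 : A z * Abar z' ≤ Abar z * A z' + σ * (2 * R) := by
      nlinarith [mul_le_mul_of_nonneg_left (hAbar z').2 hσ, mul_le_mul_of_nonneg_left (hAbar z).2 hσ,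
        mul_le_mul_of_nonneg_right s1 (hB0 z').le, mul_le_mul_of_nonneg_left s2 (hB0 z).le]
    have k2 : 1 ≤ R ^ 2 * (A z' * Abar z') := by
      have a1 := (inv_le_iff_one_le_mul₀ hR0).1 (hA z').1
      have a2 := (inv_le_iff_one_le_mul₀ hR0).1 (hAbar z').1
      nlinarith
    have k3 : σ * (2 * R) ≤ (R ^ 2 * (A z' * Abar z')) * (σ * (2 * R)) :=
      le_mul_of_one_le_left (by positivity) k2
    have hb := hB0 z'
    rw [mul_div_assoc', div_add' _ _ _ hb.ne', le_div_iff₀ hb]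
    nlinarith
  have h2 : Abar z / Abar z' / w z ≤ (1 + φ) / w z' := by
    have := H z z'
    have hb := hB0 z'
    rw [div_right_comm, div_le_iff₀ hb]
    calc Abar z / w z ≤ (1 + φ) * (Abar z' / w z') := this
      _ = _ := by ring
  have h3 : 1 / w z ≤ R / w z' := by
    rw [div_le_div_iff₀ (hw z) (hw z')]
    linarith [hwr z' z]
  calc A z / w z ≤ (A z' * (Abar z / Abar z') + A z' * (2 * R ^ 3 * σ)) / w z :=
        div_le_div_of_nonneg_right h1 (hw z).le
    _ = A z' * (Abar z / Abar z' / w z) + A z' * (2 * R ^ 3 * σ) * (1 / w z) := by ring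
    _ ≤ A z' * ((1 + φ) / w z') + A z' * (2 * R ^ 3 * σ) * (R / w z') := by
        have := hA0 z'
        gcongr
    _ = _ := by ring

/-- Ratios of a convex combination `(1 - η) U + η W`. -/
lemma RatioLE.convexComb {U W : E → ℝ} {η θ δ ζ R : ℝ} (hη : η ∈ Set.Icc (0 : ℝ) 1)
    (hθ : 0 ≤ θ) (hδ : 0 ≤ δ) (hζ : 0 ≤ ζ)
    (hU : RatioLE U (1 + θ)) (hW : RatioLE W (1 + ((1 - δ) * θ + ζ)))
    (hlow : ∀ z, ((1 - η) * U z + η * W z) / R ≤ W z)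
    (hup : ∀ z, W z ≤ R * ((1 - η) * U z + η * W z)) :
    RatioLE (fun z => (1 - η) * U z + η * W z) (1 + ((1 - δ / R * η) * θ + η * (R * ζ))) := by
  intro z z'
  dsimp only
  have h1 := mul_le_mul_of_nonneg_left (hU z z') (sub_nonneg.2 hη.2)
  have h2 := mul_le_mul_of_nonneg_left (hW z z') hη.1
  have h3 := mul_le_mul_of_nonneg_left (hlow z') (mul_nonneg hη.1 (mul_nonneg hδ hθ))
  have h4 := mul_le_mul_of_nonneg_left (hup z') (mul_nonneg hη.1 hζ)
  -- The gain `δ θ` acts on the `W` part only, and `W` is at least `T / R`; the loss `ζ` is weighted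
  -- by `W ≤ R T`.
  set T := (1 - η) * U z' + η * W z' with hT
  have e : (1 + ((1 - δ / R * η) * θ + η * (R * ζ))) * T
      = (1 + θ) * T - η * (δ * θ) * (T / R) + η * ζ * (R * T) := by ring
  rw [e]
  have : (1 + θ) * T = (1 - η) * ((1 + θ) * U z') + η * ((1 + θ) * W z') := by rw [hT]; ring
  linarith

end OnlineSinkhorn
end

/-! ### The iteration on scalings and one perturbed half-step. -/

noncomputable section

namespace OnlineSinkhorn

variable {E : Type*}

/-- The average of `φ / v` over the points `y i`, `n ≤ i < n + m`. -/
def batchMean (φ v : E → ℝ) (y : ℕ → E) (n m : ℕ) : ℝ :=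
  (∑ i ∈ Finset.Ico n (n + m), φ (y i) / v (y i)) / m

/-- The scalings `exp (-f_t / ε)`, `exp (-g_t / ε)` of online Sinkhorn with kernel
`k = exp (-C / ε)`. -/
def scalings (k : E → E → ℝ) (η : ℕ → ℝ) (n₀ : ℕ) (B : ℕ → ℕ) (x y : ℕ → E) :
    ℕ → (E → ℝ) × (E → ℝ)
  | 0 => (fun z => ∑ i ∈ Finset.range n₀, k z (y i), fun z => ∑ i ∈ Finset.range n₀, k (x i) z)
  | t + 1 =>
    let s := scalings k η n₀ B x y t
    let u : E → ℝ := fun z => (1 - η (t + 1)) * s.1 z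
      + η (t + 1) * batchMean (k z) s.2 y (sampleCount n₀ B t) (B (t + 1))
    (u, fun z => (1 - η (t + 1)) * s.2 z
      + η (t + 1) * batchMean (fun x => k x z) u x (sampleCount n₀ B t) (B (t + 1)))

lemma sampleCount_succ (n₀ : ℕ) (B : ℕ → ℕ) (t : ℕ) :
    sampleCount n₀ B (t + 1) = sampleCount n₀ B t + B (t + 1) := by
  unfold sampleCount
  rw [Finset.sum_Icc_succ_top (by omega)]
  omega

section batchMean

variable {k : E → E → ℝ} {ρ : ℝ} {v : E → ℝ} {y : ℕ → E} {n m : ℕ}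

lemma batchMean_pos {φ : E → ℝ} (hφ : ∀ z, 0 < φ z) (hv : ∀ z, 0 < v z) (hm : 1 ≤ m) :
    0 < batchMean φ v y n m := by
  unfold batchMean
  have hm' : (0 : ℝ) < m := by exact_mod_cast hm
  refine div_pos (Finset.sum_pos (fun i _ => div_pos (hφ _) (hv _)) ?_) hm'
  exact Finset.nonempty_Ico.2 (by omega)

lemma RatioLE.batchMean {r : ℝ} (hk : ∀ y, RatioLE (fun z => k z y) r) (hv : ∀ z, 0 < v z) :
    RatioLE (fun z => batchMean (k z) v y n m) r := by
  unfold OnlineSinkhorn.batchMean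
  exact (RatioLE.sum fun i _ => (hk (y i)).div_const (hv _).le).div_const (Nat.cast_nonneg _)

/-- An average of values in an interval lies in that interval. -/
lemma mul_batchMean_mem {φ : E → ℝ} {s l r : ℝ} (hm : 1 ≤ m)
    (h : ∀ y, s * (φ y / v y) ∈ Set.Icc l r) : s * batchMean φ v y n m ∈ Set.Icc l r := by
  have hm' : (0 : ℝ) < m := by exact_mod_cast hm
  have e : s * OnlineSinkhorn.batchMean φ v y n m
      = (∑ i ∈ Finset.Ico n (n + m), s * (φ (y i) / v (y i))) / m := by
    unfold OnlineSinkhorn.batchMean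
    rw [← Finset.mul_sum, mul_div_assoc]
  have hc : ((Finset.Ico n (n + m)).card : ℝ) = m := by simp
  rw [e, Set.mem_Icc, le_div_iff₀ hm', div_le_iff₀ hm', ← hc]
  constructor
  · have := Finset.card_nsmul_le_sum (Finset.Ico n (n + m)) (fun i => s * (φ (y i) / v (y i))) l
      (fun i _ => (h _).1)
    rw [nsmul_eq_mul] at this
    linarith
  · have := Finset.sum_le_card_nsmul (Finset.Ico n (n + m)) (fun i => s * (φ (y i) / v (y i))) r
      (fun i _ => (h _).2)
    rw [nsmul_eq_mul] at this
    linarith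

lemma ratioLE_of_bounds {φ : E → ℝ} (hρ : 1 ≤ ρ) (h : ∀ z, φ z ∈ Set.Icc ρ⁻¹ ρ) :
    RatioLE φ (ρ ^ 2) := fun z z' => by
  have hρ0 : 0 < ρ := by linarith
  calc φ z ≤ ρ := (h z).2
    _ = ρ ^ 2 * ρ⁻¹ := by field_simp
    _ ≤ ρ ^ 2 * φ z' := by
      have := (h z').1
      gcongr

/-- The iteration commutes with `(u, v) ↦ (c u, v / c)`, so `v` has no intrinsic size. Multiplying
by a value `s` of `v` removes this freedom and leaves bounds in terms of `ρ` only. -/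
lemma mul_div_mem_Icc {a s w : ℝ} (hρ : 1 ≤ ρ) (ha : a ∈ Set.Icc ρ⁻¹ ρ) (hs : 0 < s) (hw : 0 < w)
    (h1 : s ≤ ρ ^ 2 * w) (h2 : w ≤ ρ ^ 2 * s) :
    s * (a / w) ∈ Set.Icc ((ρ ^ 3)⁻¹) (ρ ^ 3) := by
  have hρ0 : 0 < ρ := by linarith
  have ha0 : 0 < a := (inv_pos.2 hρ0).trans_le ha.1
  have e : s * (a / w) = a * (s / w) := by ring
  have h3 : s / w ≤ ρ ^ 2 := (div_le_iff₀ hw).2 h1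
  have h4 : (ρ ^ 2)⁻¹ ≤ s / w := by
    rw [le_div_iff₀ hw, inv_mul_le_iff₀ (by positivity)]
    exact h2
  have h5 : 0 < s / w := div_pos hs hw
  rw [e]
  constructor
  · calc (ρ ^ 3)⁻¹ = ρ⁻¹ * (ρ ^ 2)⁻¹ := by rw [← mul_inv]; ring_nf
      _ ≤ a * (s / w) := mul_le_mul ha.1 h4 (by positivity) ha0.le
  · calc a * (s / w) ≤ ρ * ρ ^ 2 := mul_le_mul ha.2 h3 h5.le hρ0.le
      _ = ρ ^ 3 := by ring

end batchMean

section scalings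

variable {k : E → E → ℝ} {ρ : ℝ} {η : ℕ → ℝ} {n₀ : ℕ} {B : ℕ → ℕ} (x y : ℕ → E)

/-- Every scaling is a positive combination of sections of `k`, and a bound on ratios survives
positive combinations. The bound is therefore uniform in `t` and in the samples. -/
lemma scalings_pos_and_ratioLE (hρ : 1 ≤ ρ) (hk : ∀ x y, k x y ∈ Set.Icc ρ⁻¹ ρ)
    (hη : ∀ t, 1 ≤ t → 0 < η t ∧ η t ≤ 1)
    (hB : ∀ t, 1 ≤ t → 1 ≤ B t) (hn : 1 ≤ n₀) (t : ℕ) :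
    ((∀ z, 0 < (scalings k η n₀ B x y t).1 z) ∧ RatioLE (scalings k η n₀ B x y t).1 (ρ ^ 2)) ∧
    (∀ z, 0 < (scalings k η n₀ B x y t).2 z) ∧ RatioLE (scalings k η n₀ B x y t).2 (ρ ^ 2) := by
  have hρ0 : 0 < ρ := by linarith
  have hk0 : ∀ x y, 0 < k x y := fun x y => (inv_pos.2 hρ0).trans_le (hk x y).1
  have hk1 : ∀ y, RatioLE (fun z => k z y) (ρ ^ 2) := fun y => ratioLE_of_bounds hρ fun z => hk z y
  have hk2 : ∀ x, RatioLE (fun z => k x z) (ρ ^ 2) := fun x => ratioLE_of_bounds hρ fun z => hk x z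
  induction t with
  | zero =>
    refine ⟨⟨fun z => ?_, ?_⟩, fun z => ?_, ?_⟩
    · exact Finset.sum_pos (fun i _ => hk0 _ _) (Finset.nonempty_range_iff.2 (by omega))
    · exact RatioLE.sum (s := Finset.range n₀) (h := fun i z => k z (y i)) fun i _ => hk1 _
    · exact Finset.sum_pos (fun i _ => hk0 _ _) (Finset.nonempty_range_iff.2 (by omega))
    · exact RatioLE.sum (s := Finset.range n₀) (h := fun i z => k (x i) z) fun i _ => hk2 _
  | succ t ih =>
    obtain ⟨⟨u0, ur⟩, v0, vr⟩ := ih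
    obtain ⟨e0, e1⟩ := hη (t + 1) (by omega)
    have hb := hB (t + 1) (by omega)
    have U : (∀ z, 0 < (scalings k η n₀ B x y (t + 1)).1 z) ∧
        RatioLE (scalings k η n₀ B x y (t + 1)).1 (ρ ^ 2) := by
      refine ⟨fun z => ?_, ?_⟩
      · exact add_pos_of_nonneg_of_pos (mul_nonneg (by linarith) (u0 z).le)
          (mul_pos e0 (batchMean_pos (hk0 z) v0 hb))
      · exact (ur.const_mul (by linarith)).add ((RatioLE.batchMean hk1 v0).const_mul e0.le)
    refine ⟨U, fun z => ?_, ?_⟩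
    · exact add_pos_of_nonneg_of_pos (mul_nonneg (by linarith) (v0 z).le)
        (mul_pos e0 (batchMean_pos (fun x => hk0 x z) U.1 hb))
    · exact (vr.const_mul (by linarith)).add
        ((RatioLE.batchMean (k := fun z x => k x z) hk2 U.1).const_mul e0.le)

/-- The products of the two scalings stay in a fixed interval from the first iteration on. -/
lemma scalings_mul_mem (hρ : 1 ≤ ρ) (hk : ∀ x y, k x y ∈ Set.Icc ρ⁻¹ ρ)
    (hη : ∀ t, 1 ≤ t → 0 < η t ∧ η t ≤ 1) (hη1 : η 1 = 1)
    (hB : ∀ t, 1 ≤ t → 1 ≤ B t) (hn : 1 ≤ n₀) (t : ℕ) :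
    (∀ z z', (scalings k η n₀ B x y t).2 z' * (scalings k η n₀ B x y (t + 1)).1 z
      ∈ Set.Icc ((ρ ^ 3)⁻¹) (ρ ^ 3)) ∧
    ∀ z z', (scalings k η n₀ B x y (t + 1)).1 z * (scalings k η n₀ B x y (t + 1)).2 z'
      ∈ Set.Icc ((ρ ^ 3)⁻¹) (ρ ^ 3) := by
  have comb : ∀ {e p q l r : ℝ}, 0 < e → e ≤ 1 → (1 - e = 0 ∨ p ∈ Set.Icc l r) → q ∈ Set.Icc l r →
      (1 - e) * p + e * q ∈ Set.Icc l r := by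
    intro e p q l r h0 h1 hp hq
    rcases hp with hp | hp
    · have : e = 1 := by linarith
      simpa [this] using hq
    · have := convex_Icc l r hp hq (sub_nonneg.2 h1) h0.le (by ring)
      simpa using this
  have step : ∀ t, (1 - η (t + 1) = 0 ∨ ∀ z z', (scalings k η n₀ B x y t).1 z *
      (scalings k η n₀ B x y t).2 z' ∈ Set.Icc ((ρ ^ 3)⁻¹) (ρ ^ 3)) →
      (∀ z z', (scalings k η n₀ B x y t).2 z' * (scalings k η n₀ B x y (t + 1)).1 z
      ∈ Set.Icc ((ρ ^ 3)⁻¹) (ρ ^ 3)) ∧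
    ∀ z z', (scalings k η n₀ B x y (t + 1)).1 z * (scalings k η n₀ B x y (t + 1)).2 z'
      ∈ Set.Icc ((ρ ^ 3)⁻¹) (ρ ^ 3) := by
    intro t h
    obtain ⟨-, v0, vr⟩ := scalings_pos_and_ratioLE x y hρ hk hη hB hn t
    obtain ⟨⟨u0, ur⟩, -⟩ := scalings_pos_and_ratioLE x y hρ hk hη hB hn (t + 1)
    obtain ⟨e0, e1⟩ := hη (t + 1) (by omega)
    have hb := hB (t + 1) (by omega)
    have F : ∀ z z', (scalings k η n₀ B x y t).2 z' * (scalings k η n₀ B x y (t + 1)).1 z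
        ∈ Set.Icc ((ρ ^ 3)⁻¹) (ρ ^ 3) := by
      intro z z'
      have e : (scalings k η n₀ B x y t).2 z' * (scalings k η n₀ B x y (t + 1)).1 z
          = (1 - η (t + 1)) * ((scalings k η n₀ B x y t).1 z * (scalings k η n₀ B x y t).2 z')
            + η (t + 1) * ((scalings k η n₀ B x y t).2 z' *
              batchMean (k z) (scalings k η n₀ B x y t).2 y (sampleCount n₀ B t) (B (t + 1))) := by
        simp only [scalings]
        ring
      rw [e]
      refine comb e0 e1 (h.imp_right fun h => h z z') (mul_batchMean_mem hb fun w => ?_)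
      exact mul_div_mem_Icc hρ (hk _ _) (v0 _) (v0 _) (vr _ _) (vr _ _)
    refine ⟨F, fun z z' => ?_⟩
    have e : (scalings k η n₀ B x y (t + 1)).1 z * (scalings k η n₀ B x y (t + 1)).2 z'
        = (1 - η (t + 1)) * ((scalings k η n₀ B x y t).2 z' * (scalings k η n₀ B x y (t + 1)).1 z)
          + η (t + 1) * ((scalings k η n₀ B x y (t + 1)).1 z *
            batchMean (fun w => k w z') (scalings k η n₀ B x y (t + 1)).1 x
              (sampleCount n₀ B t) (B (t + 1))) := by
      simp only [scalings]
      ring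
    rw [e]
    refine comb e0 e1 (Or.inr (F z z')) (mul_batchMean_mem hb fun w => ?_)
    exact mul_div_mem_Icc hρ (hk _ _) (u0 _) (u0 _) (ur _ _) (ur _ _)
  induction t with
  -- The product of the initial scalings grows with `n₀`, but it enters with weight `1 - η 1 = 0`.
  -- This keeps the constants independent of `n₀`.
  | zero => exact step 0 (Or.inl (by simp [hη1]))
  | succ t ih => exact step (t + 1) (Or.inr ih.2)

end scalings

/-- One half-iteration: the ratios of `(1 - η) u + η A` relative to the fixed point `w`, where `A`
approximates the Sinkhorn update `∫ k (·, y) / v y dμ(y)` up to a relative error `σ`. -/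
lemma RatioLE.halfStep [Nonempty E] [MeasurableSpace E] {μ : Measure E}
    [IsProbabilityMeasure μ] {k : E → E → ℝ} {ρ : ℝ}
    {w w' u v A : E → ℝ} {s η θ τ σ : ℝ} (hρ : 1 ≤ ρ) (hk : ∀ x y, k x y ∈ Set.Icc ρ⁻¹ ρ)
    (hkm : ∀ x, Measurable (k x)) (hw : ∀ z, 0 < w z) (hw' : ∀ z, 0 < w' z)
    (hww : ∀ z z', w z * w' z' ≤ ρ ^ 2) (hwm : Measurable w')
    (hwi : ∀ z, w z = ∫ y, k z y / w' y ∂μ) (hwr : RatioLE w (ρ ^ 2)) (hw'r : RatioLE w' (ρ ^ 2))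
    (hv0 : ∀ z, 0 < v z) (hvm : Measurable v)
    (hη : η ∈ Set.Icc (0 : ℝ) 1) (hs : 0 < s) (hs1 : ∀ z, s ≤ ρ ^ 2 * v z)
    (hs2 : ∀ z, v z ≤ ρ ^ 2 * s)
    (hA : ∀ z, s * A z ∈ Set.Icc ((ρ ^ 3)⁻¹) (ρ ^ 3))
    (hprod : ∀ z, s * ((1 - η) * u z + η * A z) ∈ Set.Icc ((ρ ^ 3)⁻¹) (ρ ^ 3))
    (hσ0 : 0 ≤ σ) (hσ : ∀ z, |s * A z - ∫ y, s * (k z y / v y) ∂μ| ≤ σ)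
    (hθ : 0 ≤ θ) (hτ : 0 ≤ τ)
    (hu : RatioLE (fun z => u z / w z) (1 + θ))
    (hv : RatioLE (fun z => v z / w' z) (1 + (θ + τ))) :
    RatioLE (fun z => ((1 - η) * u z + η * A z) / w z)
      (1 + ((1 - (ρ ^ 3)⁻¹ / ρ ^ 6 * η) * θ + η * (ρ ^ 6 * (τ + 2 * ρ ^ 12 * σ)))) := by
  have hρ0 : 0 < ρ := by linarith
  have hρ3 : 1 ≤ ρ ^ 3 := one_le_pow₀ hρ
  have hAbarI : ∀ z y, s * (k z y / v y) ∈ Set.Icc ((ρ ^ 3)⁻¹) (ρ ^ 3) := fun z y =>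
    mul_div_mem_Icc hρ (hk _ _) hs (hv0 _) (hs1 _) (hs2 _)
  have hint : ∀ z, Integrable (fun y => s * (k z y / v y)) μ := fun z =>
    Integrable.of_mem_Icc _ _ (((hkm z).div hvm).const_mul s).aemeasurable
      (Eventually.of_forall (hAbarI z))
  have hAbar : ∀ z, (ρ ^ 3)⁻¹ ≤ ∫ y, s * (k z y / v y) ∂μ ∧ ∫ y, s * (k z y / v y) ∂μ ≤ ρ ^ 3 := by
    intro z
    have h1 := integral_mono (integrable_const _) (hint z) (fun y => (hAbarI z y).1)
    have h2 := integral_mono (hint z) (integrable_const _) (fun y => (hAbarI z y).2)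
    simpa using And.intro h1 h2
  have hH : RatioLE (fun y => s * (w' y / v y)) (1 + (θ + τ)) := fun z z' => by
    have h := hv z' z
    have hv1 := hv0 z
    have hv2 := hv0 z'
    have hw1 := hw' z
    have hw2 := hw' z'
    dsimp only at h ⊢
    rw [mul_div_assoc', div_le_div_iff₀ hw2 hw1] at h
    rw [mul_div_assoc', mul_div_assoc', mul_div_assoc', div_le_div_iff₀ hv1 hv2]
    nlinarith
  obtain ⟨z₀⟩ := ‹Nonempty E›
  -- The update divided by `w` is an average of `s w' / v` with density `k / (w w')`. Its mass is
  -- one by the fixed point equation, and it is at least `ρ⁻¹ / ρ ^ 2`, whence `δ = (ρ ^ 3)⁻¹`.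
  have hkH : ∀ z y, k z y / (w z * w' y) * (s * (w' y / v y)) = (w z)⁻¹ * (s * (k z y / v y)) := by
    intro z y
    have := (hv0 y).ne'
    have := (hw z).ne'
    have := (hw' y).ne'
    field_simp
  have hki : ∀ z, Integrable (fun y => k z y / (w z * w' y)) μ := by
    intro z
    have hb : ∀ y, w' z₀ * (k z y / w' y) ∈ Set.Icc ((ρ ^ 3)⁻¹) (ρ ^ 3) := fun y =>
      mul_div_mem_Icc hρ (hk _ _) (hw' _) (hw' _) (hw'r _ _) (hw'r _ _)
    have h1 : Integrable (fun y => w' z₀ * (k z y / w' y)) μ :=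
      Integrable.of_mem_Icc _ _ (((hkm z).div hwm).const_mul _).aemeasurable
        (Eventually.of_forall hb)
    refine (h1.const_mul ((w z)⁻¹ * (w' z₀)⁻¹)).congr (Eventually.of_forall fun y => ?_)
    have := (hw' z₀).ne'
    have := (hw z).ne'
    have := (hw' y).ne'
    dsimp only
    field_simp
  have M : RatioLE (fun z => (∫ y, s * (k z y / v y) ∂μ) / w z)
      (1 + (1 - (ρ ^ 3)⁻¹) * (θ + τ)) := by
    have := RatioLE.integral_markov (μ := μ) (k := fun z y => k z y / (w z * w' y))
      (H := fun y => s * (w' y / v y)) (δ := (ρ ^ 3)⁻¹) (θ := θ + τ) ?_ hki ?_ ?_ hH (by positivity)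
      (by positivity) ?_ ?_
    · refine fun z z' => ?_
      have h := this z z'
      simp only [hkH, integral_const_mul] at h
      simpa only [integral_const_mul, div_eq_inv_mul] using h
    · intro z y
      rw [le_div_iff₀ (mul_pos (hw _) (hw' _))]
      calc (ρ ^ 3)⁻¹ * (w z * w' y) ≤ (ρ ^ 3)⁻¹ * ρ ^ 2 := by gcongr; exact hww z y
        _ = ρ⁻¹ := by field_simp
        _ ≤ _ := (hk z y).1
    · intro z
      have e : ∀ y, k z y / (w z * w' y) = (w z)⁻¹ * (k z y / w' y) := fun y => by
        rw [div_mul_eq_div_div, div_right_comm, div_eq_inv_mul]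
      simp only [e, integral_const_mul]
      rw [← hwi z, inv_mul_cancel₀ (hw z).ne']
    · intro y
      exact mul_pos hs (div_pos (hw' y) (hv0 y))
    · refine Integrable.of_mem_Icc 0 ((1 + (θ + τ)) * (s * (w' z₀ / v z₀)))
        (((hwm.div hvm).const_mul s)).aemeasurable (Eventually.of_forall fun y => ⟨?_, hH y z₀⟩)
      exact (mul_pos hs (div_pos (hw' y) (hv0 y))).le
    · intro z
      simp only [hkH]
      exact (hint z).const_mul _
  have N := RatioLE.of_abs_sub_le (A := fun z => s * A z) (w := w) (R := ρ ^ 3) hw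
    (hwr.mono (fun z => (hw z).le) (pow_le_pow_right₀ hρ (by norm_num))) hρ3 hσ0
    (fun z => hA z) hAbar hσ M
  have hAw0 : ∀ z, 0 ≤ s * A z / w z := fun z =>
    div_nonneg ((by positivity : 0 ≤ (ρ ^ 3)⁻¹).trans (hA z).1) (hw z).le
  have W : RatioLE (fun z => s * A z / w z)
      (1 + ((1 - (ρ ^ 3)⁻¹) * θ + (τ + 2 * ρ ^ 12 * σ))) := by
    refine N.mono hAw0 ?_
    have : (1 - (ρ ^ 3)⁻¹) * τ ≤ τ := mul_le_of_le_one_left hτ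
      (by have : 0 < (ρ ^ 3)⁻¹ := by positivity
          linarith)
    have e : (ρ ^ 3) ^ 4 = ρ ^ 12 := by ring
    rw [e]
    linarith
  have hu' : RatioLE (fun z => s * u z / w z) (1 + θ) := by
    simpa only [mul_div_assoc] using hu.const_mul hs.le
  have e6 : ρ ^ 6 = ρ ^ 3 * ρ ^ 3 := by ring
  -- Both `s A` and `s` times the new scaling lie in `[ρ⁻³, ρ³]`, so each is at most `ρ ^ 6` times
  -- the other.
  have key := RatioLE.convexComb hη hθ (by positivity : 0 ≤ (ρ ^ 3)⁻¹)
    (by positivity : 0 ≤ τ + 2 * ρ ^ 12 * σ) (R := ρ ^ 6) hu' W ?_ ?_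
  · have := key.const_mul (inv_nonneg.2 hs.le)
    have e : ∀ z, s⁻¹ * ((1 - η) * (s * u z / w z) + η * (s * A z / w z))
        = ((1 - η) * u z + η * A z) / w z := fun z => by
      have := (hw z).ne'
      field_simp
    simpa only [e] using this
  all_goals
    intro z
    have e : (1 - η) * (s * u z / w z) + η * (s * A z / w z)
        = s * ((1 - η) * u z + η * A z) / w z := by ring
    have h1 := hprod z
    have h2 := hA z
    have hw0 := hw z
    rw [e]
  · rw [div_right_comm]
    gcongr
    rw [div_le_iff₀ (by positivity), e6]
    calc _ ≤ ρ ^ 3 := h1.2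
      _ = (ρ ^ 3)⁻¹ * (ρ ^ 3 * ρ ^ 3) := by field_simp
      _ ≤ _ := by gcongr; exact h2.1
  · rw [mul_div_assoc']
    refine div_le_div_of_nonneg_right ?_ hw0.le
    rw [e6]
    calc _ ≤ ρ ^ 3 := h2.2
      _ = (ρ ^ 3 * ρ ^ 3) * (ρ ^ 3)⁻¹ := by field_simp
      _ ≤ _ := by gcongr; exact h1.1

end OnlineSinkhorn
end

/-! ### Covering numbers, a maximal inequality and chaining. -/

noncomputable section

namespace OnlineSinkhorn

/-- The covering numbers at the dyadic scales `2 ^ (-k)` grow at most geometrically. -/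
def GeometricCovering (E : Type*) [PseudoMetricSpace E] (A : ℕ) : Prop :=
  1 ≤ A ∧ ∀ k : ℕ, ∃ N : Finset E, N.card ≤ A ^ (k + 1) ∧ ∀ x, ∃ p ∈ N, dist x p ≤ (1 / 2) ^ k

/-- Points in the same cell of a cubic grid of mesh `1 / m`, `m = (d + 1) 2 ^ k`, are at distance at
most `√d / m ≤ 2 ^ (-k)`, so one point per cell is a net. -/
lemma exists_geometricCovering {d : ℕ} {X : Set (EuclideanSpace ℝ (Fin d))} (hX : IsCompact X)
    [Nonempty X] : ∃ A, GeometricCovering X A := by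
  obtain ⟨r, hr⟩ : ∃ r : ℕ, ∀ x : X, ∀ i, |(x : EuclideanSpace ℝ (Fin d)) i| ≤ r := by
    obtain ⟨R, hR⟩ := hX.isBounded.exists_norm_le
    obtain ⟨r, hr⟩ := exists_nat_ge R
    refine ⟨r, fun x i => ?_⟩
    have h1 := PiLp.norm_apply_le (x : EuclideanSpace ℝ (Fin d)) i
    rw [Real.norm_eq_abs] at h1
    exact h1.trans ((hR _ x.2).trans hr)
  set a : ℕ := 2 * (r * (d + 1)) + 1 with ha
  refine ⟨(2 * a) ^ d, Nat.one_le_pow _ _ (by omega), fun k => ?_⟩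
  set m : ℕ := (d + 1) * 2 ^ k with hm
  have hm0 : (0 : ℝ) < m := by rw [hm]; positivity
  let φ : X → Fin d → ℤ := fun x i => ⌊(x : EuclideanSpace ℝ (Fin d)) i * m⌋
  let S : Finset (Fin d → ℤ) := Fintype.piFinset fun _ => Finset.Icc (-(r * m : ℤ)) (r * m)
  have hφS : ∀ x, φ x ∈ S := by
    intro x
    refine Fintype.mem_piFinset.2 fun i => Finset.mem_Icc.2 ?_
    have h1 := abs_le.1 (hr x i)
    constructor
    · refine Int.le_floor.2 ?_
      push_cast
      nlinarith [h1.1]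
    · have : (x : EuclideanSpace ℝ (Fin d)) i * m ≤ ((r * m : ℤ) : ℝ) := by
        push_cast
        exact mul_le_mul_of_nonneg_right h1.2 hm0.le
      exact Int.cast_le.1 ((Int.floor_le _).trans this)
  classical
  -- `Function.invFun` picks the representative of a cell. On a cell that misses `X` it returns an
  -- arbitrary point, which is harmless because only the number of cells matters.
  refine ⟨S.image (Function.invFun φ), ?_, fun x =>
    ⟨Function.invFun φ (φ x), Finset.mem_image_of_mem _ (hφS x), ?_⟩⟩
  · have hc : S.card = (2 * (r * m) + 1) ^ d := by
      simp only [S, Fintype.card_piFinset, Int.card_Icc, Finset.prod_const, Finset.card_univ,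
        Fintype.card_fin]
      congr 1
      have : ((r * m : ℤ) + 1 - -(r * m : ℤ)) = ((2 * (r * m) + 1 : ℕ) : ℤ) := by push_cast; ring
      rw [this, Int.toNat_natCast]
    refine Finset.card_image_le.trans ?_
    rw [hc, ← pow_mul, mul_comm d, pow_mul]
    refine Nat.pow_le_pow_left ?_ d
    have h2 : 1 ≤ 2 ^ k := Nat.one_le_two_pow
    have h3 : a ^ 1 ≤ a ^ (k + 1) := Nat.pow_le_pow_right (by omega) (by omega)
    calc 2 * (r * m) + 1 ≤ a * 2 ^ k := by rw [hm, ha]; nlinarith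
      _ ≤ a ^ (k + 1) * 2 ^ (k + 1) := by
          refine Nat.mul_le_mul (by simpa using h3) (Nat.pow_le_pow_right (by omega) (by omega))
      _ = (2 * a) ^ (k + 1) := by rw [← mul_pow, mul_comm]
  · set p := Function.invFun φ (φ x) with hp
    have hpx : φ p = φ x := Function.invFun_eq ⟨x, rfl⟩
    have hi : ∀ i, dist ((x : EuclideanSpace ℝ (Fin d)) i) ((p : EuclideanSpace ℝ (Fin d)) i)
        ≤ 1 / m := by
      intro i
      have h1 := Int.abs_sub_lt_one_of_floor_eq_floor (congrFun hpx.symm i)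
      rw [← sub_mul, abs_mul, abs_of_pos hm0] at h1
      rw [Real.dist_eq, le_div_iff₀ hm0]
      exact h1.le
    rw [Subtype.dist_eq, EuclideanSpace.dist_eq]
    refine Real.sqrt_le_iff.2 ⟨by positivity, ?_⟩
    calc _ ≤ ∑ _i : Fin d, (1 / (m : ℝ)) ^ 2 :=
          Finset.sum_le_sum fun i _ => pow_le_pow_left₀ dist_nonneg (hi i) 2
      _ = d * (1 / (m : ℝ)) ^ 2 := by simp
      _ ≤ ((d + 1) * (1 / (m : ℝ))) ^ 2 := by
          rw [mul_pow]
          gcongr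
          nlinarith
      _ = _ := by
          rw [hm, one_div_pow (2 : ℝ)]
          push_cast
          field_simp

variable {Ω : Type*} [MeasurableSpace Ω] {P : Measure Ω} [IsProbabilityMeasure P]

/-- A maximal inequality for finitely many variables with an exponential moment. -/
lemma exists_max_bound {ι : Type*} (F : Finset ι) {w : ι → Ω → ℝ} {A k : ℕ} (hA : 1 ≤ A)
    (hF : F.card ≤ A ^ (k + 1)) (hw : ∀ i ∈ F, Measurable (w i))
    (hexp : ∀ i ∈ F, ∫⁻ ω, ENNReal.ofReal (Real.exp |w i ω|) ∂P ≤ 4) :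
    ∃ σ : Ω → ℝ, Integrable σ P ∧ (∀ i ∈ F, ∀ ω, |w i ω| ≤ σ ω) ∧
      ∫ ω, σ ω ∂P ≤ (k + 1) * Real.log (4 * A) := by
  have hA' : (1 : ℝ) ≤ A := by exact_mod_cast hA
  set c : ℝ := (4 * A) ^ (k + 1) with hc
  have hc0 : 0 < c := by positivity
  have hi : ∀ i ∈ F, Integrable (fun ω => Real.exp |w i ω|) P := by
    intro i hiF
    refine ⟨((hw i hiF).abs.exp).aestronglyMeasurable, ?_⟩
    rw [hasFiniteIntegral_iff_ofReal (Eventually.of_forall fun _ => (Real.exp_pos _).le)]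
    exact (hexp i hiF).trans_lt (by simp)
  have hi4 : ∀ i ∈ F, ∫ ω, Real.exp |w i ω| ∂P ≤ 4 := by
    intro i hiF
    rw [integral_eq_lintegral_of_nonneg_ae (Eventually.of_forall fun _ => (Real.exp_pos _).le)
      ((hw i hiF).abs.exp).aestronglyMeasurable]
    exact ENNReal.toReal_le_of_le_ofReal (by norm_num) (by simpa using hexp i hiF)
  have hs : Integrable (fun ω => (∑ i ∈ F, Real.exp |w i ω|) / c) P :=
    (integrable_finsetSum F hi).div_const c
  -- This is `log x ≤ x - 1` at `x = exp |w i| / c`. Since `c` dominates the expected sum, the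
  -- expectation is at most `log c`. The explicit majorant replaces the maximum, and its
  -- integrability is immediate.
  refine ⟨fun ω => (∑ i ∈ F, Real.exp |w i ω|) / c + (Real.log c - 1),
    hs.add (integrable_const _), fun i hiF ω => ?_, ?_⟩
  · have h1 : Real.exp |w i ω| ≤ ∑ i ∈ F, Real.exp |w i ω| :=
      Finset.single_le_sum (f := fun i => Real.exp |w i ω|) (fun _ _ => (Real.exp_pos _).le) hiF
    have h2 := Real.log_le_sub_one_of_pos (div_pos (Real.exp_pos |w i ω|) hc0)
    rw [Real.log_div (Real.exp_pos _).ne' hc0.ne', Real.log_exp] at h2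
    have h3 := div_le_div_of_nonneg_right h1 hc0.le
    linarith
  · rw [integral_add hs (integrable_const _), integral_div, integral_finsetSum F hi]
    have h1 : ∑ i ∈ F, ∫ ω, Real.exp |w i ω| ∂P ≤ c := by
      calc _ ≤ ∑ i ∈ F, (4 : ℝ) := Finset.sum_le_sum hi4
        _ = F.card * 4 := by simp
        _ ≤ A ^ (k + 1) * 4 ^ (k + 1) := by
            have : (4 : ℝ) ≤ 4 ^ (k + 1) := le_self_pow₀ (by norm_num) (by omega)
            have : (F.card : ℝ) ≤ A ^ (k + 1) := by exact_mod_cast hF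
            gcongr
        _ = c := by rw [hc, ← mul_pow, mul_comm]
    have h2 := (div_le_one hc0).2 h1
    have h3 : Real.log c = (k + 1) * Real.log (4 * A) := by rw [hc, Real.log_pow]; push_cast; ring
    simp only [integral_const, probReal_univ, smul_eq_mul, one_mul]
    linarith

lemma sum_half_pow_mul (K : ℕ) :
    ∑ j ∈ Finset.range K, (1 / 2 : ℝ) ^ j * (j + 2) = 6 - (2 * K + 6) * (1 / 2) ^ K := by
  induction K with
  | zero => norm_num
  | succ K ih =>
    rw [Finset.sum_range_succ, ih]
    push_cast
    ring

/-- Chaining: the supremum of a process with subgaussian increments of size `κ`. -/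
lemma exists_sup_bound {E : Type*} [PseudoMetricSpace E] {A : ℕ} (hA : GeometricCovering E A)
    {W : E → Ω → ℝ} {M κ : ℝ} (hM : 0 < M) (hκ : 0 < κ) (hWm : ∀ x, Measurable (W x))
    (hLip : ∀ x y ω, |W x ω - W y ω| ≤ 2 * M * dist x y)
    (hexp : ∀ x, ∫⁻ ω, ENNReal.ofReal (Real.exp |W x ω / (κ * M)|) ∂P ≤ 4)
    (hinc : ∀ x y r, 0 < r → dist x y ≤ r →
      ∫⁻ ω, ENNReal.ofReal (Real.exp |(W x ω - W y ω) / (κ * M * r)|) ∂P ≤ 4) :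
    ∃ σ : Ω → ℝ, Integrable σ P ∧ (∀ x ω, |W x ω| ≤ σ ω) ∧
      ∫ ω, σ ω ∂P ≤ M * (7 * Real.log (4 * A) + 2) * κ := by
  obtain ⟨hA1, hcov⟩ := hA
  choose N hNc hN using hcov
  choose π hπN hπ using hN
  have hA' : (1 : ℝ) ≤ A := by exact_mod_cast hA1
  have hlog : 0 ≤ Real.log (4 * A) := Real.log_nonneg (by linarith)
  have hκM : 0 < κ * M := by positivity
  have claim : ∀ K, ∃ σ : Ω → ℝ, Integrable σ P ∧ (∀ p ∈ N K, ∀ ω, |W p ω| ≤ σ ω) ∧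
      ∫ ω, σ ω ∂P ≤ κ * M * (Real.log (4 * A) *
        (1 + ∑ j ∈ Finset.range K, (1 / 2 : ℝ) ^ j * (j + 2))) := by
    intro K
    induction K with
    | zero =>
      obtain ⟨σ, hσi, hσ, hσb⟩ := exists_max_bound (P := P) (k := 0) (N 0)
        (w := fun x ω => W x ω / (κ * M)) hA1 (hNc 0)
        (fun x _ => (hWm x).div_const _) (fun x _ => hexp x)
      refine ⟨fun ω => κ * M * σ ω, hσi.const_mul _, fun p hp ω => ?_, ?_⟩
      · have := hσ p hp ω
        rwa [abs_div, abs_of_pos hκM, div_le_iff₀' hκM] at this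
      · rw [integral_const_mul]
        gcongr
        simpa using hσb
    | succ K ih =>
      obtain ⟨σ, hσi, hσ, hσb⟩ := ih
      have hr : (0 : ℝ) < (1 / 2) ^ K := by positivity
      have hr' : 0 < κ * M * (1 / 2) ^ K := by positivity
      obtain ⟨σ', hσi', hσ', hσb'⟩ := exists_max_bound (P := P) (k := K + 1) (N (K + 1))
        (w := fun x ω => (W x ω - W (π K x) ω) / (κ * M * (1 / 2) ^ K)) hA1 (hNc (K + 1))
        (fun x _ => ((hWm x).sub (hWm _)).div_const _) (fun x _ => hinc _ _ _ hr (hπ K x))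
      refine ⟨fun ω => σ ω + κ * M * (1 / 2) ^ K * σ' ω, hσi.add (hσi'.const_mul _),
        fun p hp ω => ?_, ?_⟩
      · have h1 := hσ' p hp ω
        rw [abs_div, abs_of_pos hr', div_le_iff₀' hr'] at h1
        have h2 := hσ _ (hπN K p) ω
        have h3 := abs_sub_abs_le_abs_sub (W p ω) (W (π K p) ω)
        linarith
      · rw [integral_add hσi (hσi'.const_mul _), integral_const_mul, Finset.sum_range_succ]
        have h1 := mul_le_mul_of_nonneg_left hσb' hr'.le
        push_cast at h1
        have e : κ * M * (1 / 2) ^ K * (((K : ℝ) + 1 + 1) * Real.log (4 * A))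
            = κ * M * (Real.log (4 * A) * ((1 / 2) ^ K * (K + 2))) := by ring
        rw [e] at h1
        linarith
  -- The chain stops at a scale below `κ`, where the Lipschitz bound leaves a remainder `2 M κ` of
  -- the same order as the chain. The links sum to at most `6` and the coarsest net adds `1`,
  -- whatever `K` is, so there is no logarithm of `κ`.
  obtain ⟨K, hK⟩ := exists_pow_lt_of_lt_one hκ (show (1 / 2 : ℝ) < 1 by norm_num)
  obtain ⟨σ, hσi, hσ, hσb⟩ := claim K
  refine ⟨fun ω => σ ω + 2 * M * κ, hσi.add (integrable_const _), fun x ω => ?_, ?_⟩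
  · have h1 := hσ _ (hπN K x) ω
    have h2 := (hLip x (π K x) ω).trans
      (mul_le_mul_of_nonneg_left ((hπ K x).trans hK.le) (by positivity))
    have h3 := abs_sub_abs_le_abs_sub (W x ω) (W (π K x) ω)
    linarith
  · rw [integral_add hσi (integrable_const _)]
    simp only [integral_const, probReal_univ, smul_eq_mul, one_mul]
    have h1 : ∑ j ∈ Finset.range K, (1 / 2 : ℝ) ^ j * (j + 2) ≤ 6 := by
      rw [sum_half_pow_mul]
      have : (0 : ℝ) ≤ (2 * K + 6) * (1 / 2) ^ K := by positivity
      linarith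
    have h2 : κ * M * (Real.log (4 * A) * (1 + ∑ j ∈ Finset.range K, (1 / 2 : ℝ) ^ j * (j + 2)))
        ≤ κ * M * (Real.log (4 * A) * (1 + 6)) := by gcongr
    linarith

end OnlineSinkhorn
end

/-! ### Concentration of averages over fresh samples, given the past. -/

noncomputable section

namespace OnlineSinkhorn

variable {Ω : Type*} [MeasurableSpace Ω] {P : Measure Ω} [IsProbabilityMeasure P]
  {ι E : Type*} [MeasurableSpace E] {Z : ι → Ω → E}

/-- Integrating out a variable that is independent of everything else in the integrand. -/
lemma lintegral_eq_lintegral_of_dependsOn (hZ : ∀ i, Measurable (Z i)) (hind : iIndepFun Z P)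
    {S : Finset ι} {i : ι} (hi : i ∉ S) {Φ : (ι → E) → E → ENNReal}
    (hΦ : Measurable (Function.uncurry Φ)) (hS : DependsOn Φ (S : Set ι)) :
    ∫⁻ ω, Φ (fun j => Z j ω) (Z i ω) ∂P
      = ∫⁻ ω, ∫⁻ y, Φ (fun j => Z j ω) y ∂(P.map (Z i)) ∂P := by
  classical
  obtain ⟨ω₀⟩ : Nonempty Ω := nonempty_of_isProbabilityMeasure P
  -- The coordinates outside `S` are frozen, which `Φ` does not notice. The past becomes a function
  -- of finitely many samples that are jointly independent of `Z i`.
  let ext : (S → E) → ι → E := fun p j => if h : j ∈ S then p ⟨j, h⟩ else Z j ω₀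
  have hext : Measurable ext := by
    refine measurable_pi_lambda _ fun j => ?_
    by_cases h : j ∈ S
    · simpa [ext, h] using measurable_pi_apply (⟨j, h⟩ : S)
    · simp [ext, h]
  let G : Ω → ι → E := fun ω => ext fun j => Z j ω
  have hG : Measurable G := hext.comp (measurable_pi_lambda _ fun j => hZ j)
  have hΦG : ∀ ω, Φ (fun j => Z j ω) = Φ (G ω) := fun ω => hS fun j hj => by
    have : j ∈ S := hj
    simp [G, ext, this]
  have hindG : IndepFun G (Z i) P := by
    have h := hind.indepFun_finset S {i} (by simpa using hi) hZ
    have hev : Measurable fun p : ({i} : Finset ι) → E => p ⟨i, by simp⟩ := measurable_pi_apply _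
    exact h.comp hext hev
  have hlaw := hindG.map_prod_eq_prod_map_map hG.aemeasurable (hZ i).aemeasurable
  have := Measure.isProbabilityMeasure_map (μ := P) (hZ i).aemeasurable
  simp only [hΦG]
  calc ∫⁻ ω, Φ (G ω) (Z i ω) ∂P
      = ∫⁻ z, Function.uncurry Φ z ∂(P.map fun ω => (G ω, Z i ω)) := by
        rw [lintegral_map hΦ (hG.prodMk (hZ i))]
        rfl
    _ = ∫⁻ γ, ∫⁻ y, Φ γ y ∂(P.map (Z i)) ∂(P.map G) := by
        rw [hlaw, lintegral_prod _ hΦ.aemeasurable]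
        rfl
    _ = _ := lintegral_map hΦ.lintegral_prod_right' hG

/-- Hoeffding's inequality for a sum over fresh samples of a function that may depend on the
past. -/
lemma lintegral_exp_sum_le (hZ : ∀ i, Measurable (Z i)) (hind : iIndepFun Z P)
    {μ : Measure E} [IsProbabilityMeasure μ] {e : ℕ → ι} (he : Function.Injective e)
    (hμ : ∀ i, P.map (Z (e i)) = μ) {S : Finset ι} {n : ℕ} (hn : ∀ i, n ≤ i → e i ∉ S)
    {φ : (ι → E) → E → ℝ} (hφ : Measurable (Function.uncurry φ)) (hS : DependsOn φ (S : Set ι))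
    {l : ℝ} (hl : ∀ γ y, |φ γ y| ≤ l) (h0 : ∀ γ, ∫ y, φ γ y ∂μ = 0) (c : ℝ) (m : ℕ) :
    ∫⁻ ω, ENNReal.ofReal (Real.exp (c * ∑ i ∈ Finset.Ico n (n + m),
      φ (fun j => Z j ω) (Z (e i) ω))) ∂P ≤ ENNReal.ofReal (Real.exp (m * (l ^ 2 * c ^ 2 / 2))) := by
  classical
  have hφγ : ∀ γ, Measurable (φ γ) := fun γ => hφ.comp measurable_prodMk_left
  -- Hoeffding's lemma for a frozen past `γ`.
  have one : ∀ γ, ∫⁻ y, ENNReal.ofReal (Real.exp (c * φ γ y)) ∂μ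
      ≤ ENNReal.ofReal (Real.exp (l ^ 2 * c ^ 2 / 2)) := by
    intro γ
    have hl0 : 0 ≤ l := by
      obtain ⟨y⟩ : Nonempty E := nonempty_of_isProbabilityMeasure μ
      exact (abs_nonneg _).trans (hl γ y)
    have h := hasSubgaussianMGF_of_mem_Icc_of_integral_eq_zero (μ := μ) (X := φ γ) (a := -l) (b := l)
      (hφγ γ).aemeasurable (Eventually.of_forall fun y => abs_le.1 (hl γ y)) (h0 γ)
    have h1 := h.mgf_le c
    have e1 : (((‖l - -l‖₊ / 2) ^ 2 : ℝ≥0) : ℝ) = l ^ 2 := by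
      push_cast
      rw [Real.norm_eq_abs, div_pow, sq_abs]
      ring
    rw [e1] at h1
    rw [← ofReal_integral_eq_lintegral_ofReal (h.integrable_exp_mul c)
      (Eventually.of_forall fun _ => (Real.exp_pos _).le)]
    exact ENNReal.ofReal_le_ofReal h1
  induction m with
  | zero => simp
  | succ m ih =>
    -- The last sample is integrated out first: the other factors involve only `S` and the earlier
    -- fresh samples, and injectivity of `e` keeps `e (n + m)` out of these.
    let S' : Finset ι := S ∪ (Finset.Ico n (n + m)).image e
    have hnot : e (n + m) ∉ S' := by
      simp only [S', Finset.mem_union, Finset.mem_image, Finset.mem_Ico, not_or, not_exists]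
      refine ⟨hn _ (by omega), fun j hj => ?_⟩
      have := he hj.2
      omega
    let Φ : (ι → E) → E → ENNReal := fun γ y =>
      ENNReal.ofReal (Real.exp (c * ∑ i ∈ Finset.Ico n (n + m), φ γ (γ (e i))))
        * ENNReal.ofReal (Real.exp (c * φ γ y))
    have hΨ : Measurable fun γ : ι → E =>
        ENNReal.ofReal (Real.exp (c * ∑ i ∈ Finset.Ico n (n + m), φ γ (γ (e i)))) := by
      refine (Measurable.exp (Measurable.const_mul (Finset.measurable_sum _ fun i _ => ?_) c)).ennreal_ofReal
      exact hφ.comp (measurable_id.prodMk (measurable_pi_apply (e i)))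
    have hΦ : Measurable (Function.uncurry Φ) :=
      (hΨ.comp measurable_fst).mul (hφ.const_mul c).exp.ennreal_ofReal
    have hΦS : DependsOn Φ (S' : Set ι) := by
      intro γ γ' h
      have h1 : φ γ = φ γ' := hS fun j hj => h j (by simp [S']; exact Or.inl hj)
      have h2 : ∀ i ∈ Finset.Ico n (n + m), φ γ (γ (e i)) = φ γ' (γ' (e i)) := fun i hi => by
        rw [h1, h (e i) (by simp only [S', Finset.coe_union]; exact Or.inr (by
          exact_mod_cast Finset.mem_image_of_mem e hi))]
      simp only [Φ, h1]
      rw [Finset.sum_congr rfl fun i hi => by rw [← h1, h2 i hi]]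
    have key := lintegral_eq_lintegral_of_dependsOn hZ hind hnot hΦ hΦS
    have e1 : ∀ ω, ENNReal.ofReal (Real.exp (c * ∑ i ∈ Finset.Ico n (n + (m + 1)),
        φ (fun j => Z j ω) (Z (e i) ω))) = Φ (fun j => Z j ω) (Z (e (n + m)) ω) := by
      intro ω
      rw [← add_assoc, Finset.sum_Ico_succ_top (by omega), mul_add, Real.exp_add,
        ENNReal.ofReal_mul (Real.exp_pos _).le]
    simp only [e1]
    rw [key, hμ]
    calc _ ≤ ∫⁻ ω, ENNReal.ofReal (Real.exp (c * ∑ i ∈ Finset.Ico n (n + m),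
          φ (fun j => Z j ω) (Z (e i) ω))) * ENNReal.ofReal (Real.exp (l ^ 2 * c ^ 2 / 2)) ∂P := by
          refine lintegral_mono fun ω => ?_
          simp only [Φ]
          rw [lintegral_const_mul _ ((hφγ _).const_mul c).exp.ennreal_ofReal]
          gcongr
          exact one _
      _ ≤ ENNReal.ofReal (Real.exp (m * (l ^ 2 * c ^ 2 / 2)))
          * ENNReal.ofReal (Real.exp (l ^ 2 * c ^ 2 / 2)) := by
          have h := hΨ.comp (measurable_pi_lambda _ hZ)
          rw [Function.comp_def] at h
          rw [lintegral_mul_const _ h]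
          gcongr
      _ = _ := by
          rw [← ENNReal.ofReal_mul (Real.exp_pos _).le, ← Real.exp_add]
          congr 2
          push_cast
          ring

/-- The hypothesis on `c` makes the exponential moments of both signs at most `exp (1 / 2) ≤ 2`, and
`exp |s| ≤ exp s + exp (-s)`. This is the moment condition that the chaining bound asks for. -/
lemma lintegral_exp_abs_sum_le (hZ : ∀ i, Measurable (Z i)) (hind : iIndepFun Z P)
    {μ : Measure E} [IsProbabilityMeasure μ] {e : ℕ → ι} (he : Function.Injective e)
    (hμ : ∀ i, P.map (Z (e i)) = μ) {S : Finset ι} {n : ℕ} (hn : ∀ i, n ≤ i → e i ∉ S)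
    {φ : (ι → E) → E → ℝ} (hφ : Measurable (Function.uncurry φ)) (hS : DependsOn φ (S : Set ι))
    {l : ℝ} (hl : ∀ γ y, |φ γ y| ≤ l) (h0 : ∀ γ, ∫ y, φ γ y ∂μ = 0) {c : ℝ} {m : ℕ}
    (hc : m * (l ^ 2 * c ^ 2) ≤ 1) :
    ∫⁻ ω, ENNReal.ofReal (Real.exp |c * ∑ i ∈ Finset.Ico n (n + m),
      φ (fun j => Z j ω) (Z (e i) ω)|) ∂P ≤ 4 := by
  have b : ∀ c : ℝ, m * (l ^ 2 * c ^ 2) ≤ 1 → ∫⁻ ω, ENNReal.ofReal (Real.exp (c *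
      ∑ i ∈ Finset.Ico n (n + m), φ (fun j => Z j ω) (Z (e i) ω))) ∂P ≤ 2 := by
    intro c hc
    refine (lintegral_exp_sum_le hZ hind he hμ hn hφ hS hl h0 c m).trans ?_
    rw [show (2 : ENNReal) = ENNReal.ofReal 2 by simp]
    refine ENNReal.ofReal_le_ofReal ?_
    have h1 : (m : ℝ) * (l ^ 2 * c ^ 2 / 2) ≤ 1 / 2 := by linarith
    refine (Real.exp_le_exp.2 h1).trans ?_
    have h2 : Real.exp (1 / 2) ^ 2 = Real.exp 1 := by rw [← Real.exp_nat_mul]; norm_num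
    have h3 := Real.exp_one_lt_d9
    nlinarith [Real.exp_pos (1 / 2)]
  have hm : Measurable fun ω => ENNReal.ofReal (Real.exp (c *
      ∑ i ∈ Finset.Ico n (n + m), φ (fun j => Z j ω) (Z (e i) ω))) := by
    refine (Measurable.exp (Measurable.const_mul (Finset.measurable_sum _ fun i _ => ?_) c)).ennreal_ofReal
    exact hφ.comp ((measurable_pi_lambda _ hZ).prodMk (hZ (e i)))
  calc _ ≤ ∫⁻ ω, (ENNReal.ofReal (Real.exp (c *
        ∑ i ∈ Finset.Ico n (n + m), φ (fun j => Z j ω) (Z (e i) ω)))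
        + ENNReal.ofReal (Real.exp (-c *
        ∑ i ∈ Finset.Ico n (n + m), φ (fun j => Z j ω) (Z (e i) ω)))) ∂P := by
        refine lintegral_mono fun ω => ?_
        dsimp only
        rw [← ENNReal.ofReal_add (Real.exp_pos _).le (Real.exp_pos _).le]
        refine ENNReal.ofReal_le_ofReal ?_
        rw [neg_mul]
        exact Real.exp_abs_le _
    _ ≤ 2 + 2 := by
        rw [lintegral_add_left hm]
        exact add_le_add (b c hc) (b (-c) (by simpa using hc))
    _ = 4 := by norm_num

/-- Uniform law of large numbers, in expectation and with the parametric rate, for averages over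
fresh samples of a Lipschitz family of functions that may depend on the past. -/
lemma exists_uniform_deviation_bound [PseudoMetricSpace E] {A : ℕ} (hA : GeometricCovering E A)
    (hZ : ∀ i, Measurable (Z i)) (hind : iIndepFun Z P)
    {μ : Measure E} [IsProbabilityMeasure μ] {e : ℕ → ι} (he : Function.Injective e)
    (hμ : ∀ i, P.map (Z (e i)) = μ) {S : Finset ι} {n : ℕ} (hn : ∀ i, n ≤ i → e i ∉ S)
    {F : E → (ι → E) → E → ℝ} (hF : ∀ x, Measurable (Function.uncurry (F x)))
    (hS : ∀ x, DependsOn (F x) (S : Set ι)) {M : ℝ} (hM : 0 < M)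
    (hFb : ∀ x γ y, |F x γ y| ≤ M / 2)
    (hFL : ∀ x x' γ y, |F x γ y - F x' γ y| ≤ M / 2 * dist x x') {m : ℕ} (hm : 1 ≤ m) :
    ∃ σ : Ω → ℝ, Integrable σ P ∧
      (∀ x ω, |(∑ i ∈ Finset.Ico n (n + m), F x (fun j => Z j ω) (Z (e i) ω)) / m
        - ∫ y, F x (fun j => Z j ω) y ∂μ| ≤ σ ω) ∧
      ∫ ω, σ ω ∂P ≤ M * (7 * Real.log (4 * A) + 2) * (Real.sqrt m)⁻¹ := by
  have hm0 : (0 : ℝ) < m := by exact_mod_cast hm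
  have hsq : 0 < Real.sqrt m := Real.sqrt_pos.2 hm0
  -- The mean is taken with the past `γ` fixed. Centring doubles both the bound and the Lipschitz
  -- constant, hence `M / 2` in the hypotheses.
  let φ : E → (ι → E) → E → ℝ := fun x γ y => F x γ y - ∫ y, F x γ y ∂μ
  have hFγ : ∀ x γ, Measurable (F x γ) := fun x γ => (hF x).comp measurable_prodMk_left
  have hFi : ∀ x γ, Integrable (F x γ) μ := fun x γ =>
    Integrable.of_mem_Icc (-(M / 2)) (M / 2) (hFγ x γ).aemeasurable
      (Eventually.of_forall fun y => abs_le.1 (hFb x γ y))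
  have hint : ∀ {f : E → ℝ} {c : ℝ}, (∀ y, |f y| ≤ c) → |∫ y, f y ∂μ| ≤ c := by
    intro f c h
    have := norm_integral_le_of_norm_le_const (μ := μ) (f := f) (C := c)
      (Eventually.of_forall fun y => h y)
    simpa using this
  have hφm : ∀ x, Measurable (Function.uncurry (φ x)) := fun x =>
    (hF x).sub ((hF x).stronglyMeasurable.integral_prod_right.measurable.comp measurable_fst)
  have hφS : ∀ x, DependsOn (φ x) (S : Set ι) := fun x γ γ' h => by
    simp only [φ, hS x h]
  have hφ0 : ∀ x γ, ∫ y, φ x γ y ∂μ = 0 := fun x γ => by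
    simp only [φ]
    rw [integral_sub (hFi x γ) (integrable_const _)]
    simp
  have hφi : ∀ x γ, Integrable (φ x γ) μ := fun x γ => (hFi x γ).sub (integrable_const _)
  have hφb : ∀ x γ y, |φ x γ y| ≤ M := fun x γ y => by
    refine (abs_sub _ _).trans ?_
    linarith [hFb x γ y, hint (hFb x γ)]
  have hφL : ∀ x x' γ y, |φ x γ y - φ x' γ y| ≤ M * dist x x' := fun x x' γ y => by
    have e1 : φ x γ y - φ x' γ y = (F x γ y - F x' γ y) - ∫ y, (F x γ y - F x' γ y) ∂μ := by
      simp only [φ]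
      rw [integral_sub (hFi x γ) (hFi x' γ)]
      ring
    rw [e1]
    refine (abs_sub _ _).trans ?_
    linarith [hFL x x' γ y, hint (hFL x x' γ)]
  let W : E → Ω → ℝ := fun x ω =>
    (∑ i ∈ Finset.Ico n (n + m), φ x (fun j => Z j ω) (Z (e i) ω)) / m
  have hW : ∀ x ω, (∑ i ∈ Finset.Ico n (n + m), F x (fun j => Z j ω) (Z (e i) ω)) / m
      - ∫ y, F x (fun j => Z j ω) y ∂μ = W x ω := fun x ω => by
    simp only [W, φ, Finset.sum_sub_distrib, Finset.sum_const, Nat.card_Ico, add_tsub_cancel_left,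
      nsmul_eq_mul, sub_div, mul_div_cancel_left₀ _ hm0.ne']
  have hWd : ∀ x x' ω, W x ω - W x' ω
      = (∑ i ∈ Finset.Ico n (n + m), (φ x (fun j => Z j ω) (Z (e i) ω)
        - φ x' (fun j => Z j ω) (Z (e i) ω))) / m := fun x x' ω => by
    simp only [W, Finset.sum_sub_distrib, sub_div]
  have hc : ∀ r, 0 < r → (m : ℝ) * ((M * r) ^ 2 * (((Real.sqrt m)⁻¹ * M * r)⁻¹ / m) ^ 2) ≤ 1 := by
    intro r hr
    have : (Real.sqrt m) ^ 2 = m := Real.sq_sqrt hm0.le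
    have e1 : (m : ℝ) * ((M * r) ^ 2 * (((Real.sqrt m)⁻¹ * M * r)⁻¹ / m) ^ 2)
        = Real.sqrt m ^ 2 / m := by field_simp
    rw [e1, this, div_self hm0.ne']
  simp only [hW]
  refine exists_sup_bound hA (κ := (Real.sqrt m)⁻¹) hM (inv_pos.2 hsq) ?_ ?_ ?_ ?_
  · intro x
    refine (Finset.measurable_sum _ fun i _ => ?_).div_const _
    exact (hφm x).comp ((measurable_pi_lambda _ hZ).prodMk (hZ (e i)))
  · intro x x' ω
    rw [hWd, abs_div, abs_of_pos hm0, div_le_iff₀ hm0]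
    refine (Finset.abs_sum_le_sum_abs _ _).trans ?_
    refine (Finset.sum_le_sum fun i _ => hφL x x' _ _).trans ?_
    simp only [Finset.sum_const, Nat.card_Ico, add_tsub_cancel_left, nsmul_eq_mul]
    have : 0 ≤ M * dist x x' * m := by positivity
    nlinarith
  · intro x
    have := lintegral_exp_abs_sum_le hZ hind he hμ hn (hφm x) (hφS x) (hφb x) (hφ0 x)
      (m := m) (c := ((Real.sqrt m)⁻¹ * M)⁻¹ / m) (by simpa using hc 1 one_pos)
    refine le_of_eq_of_le (lintegral_congr fun ω => ?_) this
    simp only [W]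
    congr 3
    ring
  · intro x x' r hr hd
    have := lintegral_exp_abs_sum_le hZ hind he hμ hn (φ := fun γ y => φ x γ y - φ x' γ y)
      ((hφm x).sub (hφm x')) (fun γ γ' h => by simp only [hφS x h, hφS x' h])
      (l := M * r) (fun γ y => (hφL x x' γ y).trans (by gcongr))
      (fun γ => by rw [integral_sub (hφi x γ) (hφi x' γ), hφ0, hφ0, sub_zero])
      (m := m) (hc r hr)
    refine le_of_eq_of_le (lintegral_congr fun ω => ?_) this
    rw [hWd]
    congr 3
    ring

end OnlineSinkhorn
end

/-! ### Dependence of the scalings on the samples, and their identification with the weights. -/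

noncomputable section

namespace OnlineSinkhorn

variable {E : Type*}

section scalings

variable {k : E → E → ℝ} {ρ : ℝ} {η : ℕ → ℝ} {n₀ : ℕ} {B : ℕ → ℕ}

lemma batchMean_congr {φ v : E → ℝ} {y y' : ℕ → E} {n m : ℕ} (h : ∀ i < n + m, y i = y' i) :
    batchMean φ v y n m = batchMean φ v y' n m := by
  unfold batchMean
  congr 1
  exact Finset.sum_congr rfl fun i hi => by rw [h i (Finset.mem_Ico.1 hi).2]

lemma scalings_fst_succ_congr_of_eq {x x' y y' : ℕ → E} {t : ℕ}
    (h : scalings k η n₀ B x y t = scalings k η n₀ B x' y' t)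
    (hy : ∀ i < sampleCount n₀ B (t + 1), y i = y' i) :
    (scalings k η n₀ B x y (t + 1)).1 = (scalings k η n₀ B x' y' (t + 1)).1 := by
  rw [sampleCount_succ] at hy
  simp only [scalings, h]
  funext z
  rw [batchMean_congr hy]

lemma scalings_congr {x x' y y' : ℕ → E} {t : ℕ} (hx : ∀ i < sampleCount n₀ B t, x i = x' i)
    (hy : ∀ i < sampleCount n₀ B t, y i = y' i) :
    scalings k η n₀ B x y t = scalings k η n₀ B x' y' t := by
  induction t with
  | zero =>
    have hn : sampleCount n₀ B 0 = n₀ := by simp [sampleCount]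
    rw [hn] at hx hy
    simp only [scalings]
    refine Prod.ext (funext fun z => ?_) (funext fun z => ?_)
    · change ∑ i ∈ Finset.range n₀, k z (y i) = ∑ i ∈ Finset.range n₀, k z (y' i)
      exact Finset.sum_congr rfl fun i hi => by rw [hy i (Finset.mem_range.1 hi)]
    · change ∑ i ∈ Finset.range n₀, k (x i) z = ∑ i ∈ Finset.range n₀, k (x' i) z
      exact Finset.sum_congr rfl fun i hi => by rw [hx i (Finset.mem_range.1 hi)]
  | succ t ih =>
    have hle : sampleCount n₀ B t ≤ sampleCount n₀ B (t + 1) := by rw [sampleCount_succ]; omega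
    have h := ih (fun i hi => hx i (hi.trans_le hle)) (fun i hi => hy i (hi.trans_le hle))
    have h1 := scalings_fst_succ_congr_of_eq h hy
    refine Prod.ext h1 ?_
    rw [sampleCount_succ] at hx
    simp only [scalings] at h1 ⊢
    funext z
    rw [h1, h, batchMean_congr hx]

/-- The new first scaling uses the new `y` batch but not the new `x` batch. The latter is thus still
fresh when the second scaling is updated. -/
lemma scalings_fst_succ_congr {x x' y y' : ℕ → E} {t : ℕ}
    (hx : ∀ i < sampleCount n₀ B t, x i = x' i)
    (hy : ∀ i < sampleCount n₀ B (t + 1), y i = y' i) :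
    (scalings k η n₀ B x y (t + 1)).1 = (scalings k η n₀ B x' y' (t + 1)).1 := by
  have hle : sampleCount n₀ B t ≤ sampleCount n₀ B (t + 1) := by rw [sampleCount_succ]; omega
  exact scalings_fst_succ_congr_of_eq (scalings_congr hx fun i hi => hy i (hi.trans_le hle)) hy

lemma continuous_batchMean [TopologicalSpace E] {T : Type*} [TopologicalSpace T]
    {φ v : T → E → ℝ} {y : T → ℕ → E} {n m : ℕ}
    (hφ : Continuous (Function.uncurry φ)) (hv : Continuous (Function.uncurry v))
    (hv0 : ∀ t z, v t z ≠ 0) (hy : ∀ i, Continuous fun t => y t i) :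
    Continuous fun t => batchMean (φ t) (v t) (y t) n m := by
  unfold batchMean
  refine (continuous_finsetSum _ fun i _ => ?_).div_const _
  exact (hφ.comp (continuous_id.prodMk (hy i))).div (hv.comp (continuous_id.prodMk (hy i)))
    fun t => hv0 _ _

/-- Joint continuity in the samples and the point is the source of all measurability below,
including that of the variation norms. -/
lemma continuous_scalings [TopologicalSpace E] (hρ : 1 ≤ ρ) (hk : ∀ x y, k x y ∈ Set.Icc ρ⁻¹ ρ)
    (hkc : Continuous (Function.uncurry k)) (hη : ∀ t, 1 ≤ t → 0 < η t ∧ η t ≤ 1)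
    (hB : ∀ t, 1 ≤ t → 1 ≤ B t) (hn : 1 ≤ n₀) (t : ℕ) :
    (Continuous fun p : (ℕ ⊕ ℕ → E) × E =>
      (scalings k η n₀ B (fun i => p.1 (.inl i)) (fun i => p.1 (.inr i)) t).1 p.2) ∧
    Continuous fun p : (ℕ ⊕ ℕ → E) × E =>
      (scalings k η n₀ B (fun i => p.1 (.inl i)) (fun i => p.1 (.inr i)) t).2 p.2 := by
  have hl : ∀ i : ℕ, Continuous fun p : (ℕ ⊕ ℕ → E) × E => p.1 (.inl i) := fun i => by fun_prop
  have hr : ∀ i : ℕ, Continuous fun p : (ℕ ⊕ ℕ → E) × E => p.1 (.inr i) := fun i => by fun_prop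
  induction t with
  | zero =>
    constructor
    · simp only [scalings]
      exact continuous_finsetSum _ fun i _ => hkc.comp (continuous_snd.prodMk (hr i))
    · simp only [scalings]
      exact continuous_finsetSum _ fun i _ => hkc.comp ((hl i).prodMk continuous_snd)
  | succ t ih =>
    have pos := fun γ : ℕ ⊕ ℕ → E => scalings_pos_and_ratioLE
      (fun i => γ (.inl i)) (fun i => γ (.inr i)) hρ hk hη hB hn
    have h1 : Continuous fun p : (ℕ ⊕ ℕ → E) × E =>
        (scalings k η n₀ B (fun i => p.1 (.inl i)) (fun i => p.1 (.inr i)) (t + 1)).1 p.2 := by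
      simp only [scalings]
      refine (ih.1.const_mul _).add (Continuous.const_mul ?_ _)
      refine continuous_batchMean (φ := fun p : (ℕ ⊕ ℕ → E) × E => k p.2)
        (v := fun p : (ℕ ⊕ ℕ → E) × E => (scalings k η n₀ B (fun i => p.1 (.inl i))
          (fun i => p.1 (.inr i)) t).2) (y := fun p i => p.1 (.inr i)) ?_ ?_ ?_ hr
      · exact hkc.comp ((continuous_snd.comp continuous_fst).prodMk continuous_snd)
      · exact ih.2.comp ((continuous_fst.comp continuous_fst).prodMk continuous_snd)
      · exact fun p z => ((pos p.1 t).2.1 z).ne'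
    refine ⟨h1, ?_⟩
    have e : ∀ p : (ℕ ⊕ ℕ → E) × E,
        (scalings k η n₀ B (fun i => p.1 (.inl i)) (fun i => p.1 (.inr i)) (t + 1)).2 p.2
        = (1 - η (t + 1)) *
          (scalings k η n₀ B (fun i => p.1 (.inl i)) (fun i => p.1 (.inr i)) t).2 p.2
          + η (t + 1) * batchMean (fun x => k x p.2)
            (scalings k η n₀ B (fun i => p.1 (.inl i)) (fun i => p.1 (.inr i)) (t + 1)).1
            (fun i => p.1 (.inl i)) (sampleCount n₀ B t) (B (t + 1)) := fun p => by
      simp only [scalings]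
    simp only [e]
    refine (ih.2.const_mul _).add (Continuous.const_mul ?_ _)
    refine continuous_batchMean (φ := fun p : (ℕ ⊕ ℕ → E) × E => fun x => k x p.2)
      (v := fun p : (ℕ ⊕ ℕ → E) × E => (scalings k η n₀ B (fun i => p.1 (.inl i))
        (fun i => p.1 (.inr i)) (t + 1)).1) (y := fun p i => p.1 (.inl i)) ?_ ?_ ?_ hl
    · exact hkc.comp (continuous_snd.prodMk (continuous_snd.comp continuous_fst))
    · exact h1.comp ((continuous_fst.comp continuous_fst).prodMk continuous_snd)
    · exact fun p z => ((pos p.1 (t + 1)).1.1 z).ne'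

end scalings

lemma sum_updateWeights_mul {ε η : ℝ} {n m : ℕ} {w h : ℕ → ℝ} {φ v : E → ℝ} {y : ℕ → E}
    (hv : ∀ i, Real.exp (h i / ε) = (v (y i))⁻¹) :
    ∑ i ∈ Finset.range (n + m), updateWeights ε η n m w h i * φ (y i)
      = (1 - η) * ∑ i ∈ Finset.range n, w i * φ (y i) + η * batchMean φ v y n m := by
  rw [← Finset.sum_range_add_sum_Ico _ (Nat.le_add_right n m)]
  unfold batchMean
  rw [mul_div_assoc', Finset.mul_sum, Finset.mul_sum, Finset.sum_div]
  congr 1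
  · refine Finset.sum_congr rfl fun i hi => ?_
    rw [updateWeights, if_pos (Finset.mem_range.1 hi)]
    ring
  · refine Finset.sum_congr rfl fun i hi => ?_
    obtain ⟨h1, h2⟩ := Finset.mem_Ico.1 hi
    rw [updateWeights, if_neg (by omega), if_pos h2, hv]
    ring

/-- The weighted kernel sums of the algorithm are the scalings. -/
lemma sum_weights_mul_eq_scalings {ε : ℝ} (hε : 0 < ε) {C : E → E → ℝ} {ρ : ℝ} {η : ℕ → ℝ} {n₀ : ℕ}
    {B : ℕ → ℕ} {k : E → E → ℝ} (hkC : ∀ x y, k x y = Real.exp (-C x y / ε)) (hρ : 1 ≤ ρ)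
    (hk : ∀ x y, k x y ∈ Set.Icc ρ⁻¹ ρ) (hη : ∀ t, 1 ≤ t → 0 < η t ∧ η t ≤ 1)
    (hB : ∀ t, 1 ≤ t → 1 ≤ B t) (hn : 1 ≤ n₀) (x y : ℕ → E) (t : ℕ) :
    (∀ z, ∑ i ∈ Finset.range (sampleCount n₀ B t),
      (weights ε C η n₀ B x y t).q i * Real.exp (-C z (y i) / ε)
        = (scalings k η n₀ B x y t).1 z) ∧
    ∀ z, ∑ i ∈ Finset.range (sampleCount n₀ B t),
      (weights ε C η n₀ B x y t).p i * Real.exp (-C (x i) z / ε)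
        = (scalings k η n₀ B x y t).2 z := by
  have pos := scalings_pos_and_ratioLE x y hρ hk hη hB hn
  have hexp : ∀ s : ℝ, 0 < s → Real.exp (-ε * Real.log s / ε) = s⁻¹ := fun s hs => by
    rw [neg_mul, neg_div, mul_div_cancel_left₀ _ hε.ne', Real.exp_neg, Real.exp_log hs]
  induction t with
  | zero =>
    have hn : sampleCount n₀ B 0 = n₀ := by simp [sampleCount]
    rw [hn]
    constructor
    all_goals
      intro z
      refine Finset.sum_congr rfl fun i hi => ?_
      simp only [weights, if_pos (Finset.mem_range.1 hi), one_mul, hkC]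
  | succ t ih =>
    have h1 : ∀ z, ∑ i ∈ Finset.range (sampleCount n₀ B (t + 1)),
        (weights ε C η n₀ B x y (t + 1)).q i * Real.exp (-C z (y i) / ε)
          = (scalings k η n₀ B x y (t + 1)).1 z := by
      intro z
      rw [sampleCount_succ]
      simp only [weights, scalings]
      rw [sum_updateWeights_mul (φ := fun w => Real.exp (-C z w / ε))
        (v := (scalings k η n₀ B x y t).2), ih.1 z]
      · simp only [← hkC]
      · intro i
        rw [weightedPotential, ih.2, hexp _ ((pos t).2.1 _)]
    refine ⟨h1, fun z => ?_⟩
    have e : ∀ i, (weights ε C η n₀ B x y (t + 1)).p i = updateWeights ε (η (t + 1))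
        (sampleCount n₀ B t) (B (t + 1)) (weights ε C η n₀ B x y t).p
        (fun i => weightedPotential ε C (sampleCount n₀ B (t + 1))
          (weights ε C η n₀ B x y (t + 1)).q y (x i)) i := fun i => by
      rw [sampleCount_succ]
      simp only [weights]
    simp only [e]
    rw [sampleCount_succ, sum_updateWeights_mul (φ := fun w => Real.exp (-C w z / ε))
        (v := (scalings k η n₀ B x y (t + 1)).1), ih.2 z]
    · simp only [← hkC, scalings]
    · intro i
      rw [← sampleCount_succ, weightedPotential, h1, hexp _ ((pos (t + 1)).1.1 _)]

end OnlineSinkhorn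
end

/-! ### The recursion for the expected ratio error. -/

noncomputable section

namespace OnlineSinkhorn

variable {Ω : Type*} [MeasurableSpace Ω] {P : Measure Ω} [IsProbabilityMeasure P]
  {E : Type*} [PseudoMetricSpace E] [SecondCountableTopology E] [MeasurableSpace E] [BorelSpace E]
  {Z : ℕ ⊕ ℕ → Ω → E}

/-- The deviation of one batch average from its mean, uniformly in the free variable. -/
lemma exists_batchMean_deviation_bound [Nonempty E] {A : ℕ} (hA : GeometricCovering E A)
    (hZ : ∀ i, Measurable (Z i)) (hind : iIndepFun Z P)
    {μ : Measure E} [IsProbabilityMeasure μ] {e : ℕ → ℕ ⊕ ℕ} (he : Function.Injective e)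
    (hμ : ∀ i, P.map (Z (e i)) = μ) {S : Finset (ℕ ⊕ ℕ)} {n : ℕ} (hn : ∀ i, n ≤ i → e i ∉ S)
    {k : E → E → ℝ} {ρ L : ℝ} (hρ : 1 ≤ ρ) (hL : 0 ≤ L) (hk : ∀ x y, k x y ∈ Set.Icc ρ⁻¹ ρ)
    (hkc : Continuous (Function.uncurry k)) (hkL : ∀ x x' y, |k x y - k x' y| ≤ L * dist x x')
    {V : (ℕ ⊕ ℕ → E) → E → ℝ} (hV : Continuous (Function.uncurry V))
    (hV0 : ∀ γ z, 0 < V γ z) (hVr : ∀ γ, RatioLE (V γ) (ρ ^ 2)) (hVS : DependsOn V (S : Set (ℕ ⊕ ℕ)))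
    (z₀ : E) {m : ℕ} (hm : 1 ≤ m) :
    ∃ σ : Ω → ℝ, Integrable σ P ∧ (∀ ω, 0 ≤ σ ω) ∧
      (∀ x ω, |V (fun j => Z j ω) z₀ * batchMean (k x) (V fun j => Z j ω) (fun i => Z (e i) ω) n m
        - ∫ y, V (fun j => Z j ω) z₀ * (k x y / V (fun j => Z j ω) y) ∂μ| ≤ σ ω) ∧
      ∫ ω, σ ω ∂P ≤ 2 * (ρ ^ 3 + ρ ^ 2 * L) * (7 * Real.log (4 * A) + 2) * (Real.sqrt m)⁻¹ := by
  have hρ0 : 0 < ρ := by linarith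
  -- The factor `V γ z₀` removes the scale of `V`, so that `F` is bounded by `ρ ^ 3` and is `ρ ^ 2 *
  -- L`-Lipschitz in `x`, uniformly in the past.
  let F : E → (ℕ ⊕ ℕ → E) → E → ℝ := fun x γ y => V γ z₀ * (k x y / V γ y)
  have hF : ∀ x, Measurable (Function.uncurry (F x)) := fun x => by
    refine Continuous.measurable ?_
    refine (hV.comp (continuous_fst.prodMk continuous_const)).mul ?_
    exact (hkc.comp (continuous_const.prodMk continuous_snd)).div hV fun p => (hV0 _ _).ne'
  have hpos : 0 ≤ ρ ^ 2 * L := by positivity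
  have hpos' : 0 < ρ ^ 3 := by positivity
  have hFb : ∀ x γ y, |F x γ y| ≤ 2 * (ρ ^ 3 + ρ ^ 2 * L) / 2 := by
    intro x γ y
    have h := mul_div_mem_Icc hρ (hk x y) (hV0 γ z₀) (hV0 γ y) (hVr γ _ _) (hVr γ _ _)
    have h0 : 0 ≤ F x γ y := (by positivity : 0 ≤ (ρ ^ 3)⁻¹).trans h.1
    rw [abs_of_nonneg h0]
    refine h.2.trans ?_
    linarith
  have hFL : ∀ x x' γ y, |F x γ y - F x' γ y| ≤ 2 * (ρ ^ 3 + ρ ^ 2 * L) / 2 * dist x x' := by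
    intro x x' γ y
    have e1 : F x γ y - F x' γ y = (V γ z₀ / V γ y) * (k x y - k x' y) := by
      simp only [F]
      ring
    have h1 : V γ z₀ / V γ y ≤ ρ ^ 2 := (div_le_iff₀ (hV0 _ _)).2 (hVr γ _ _)
    have h2 : 0 ≤ V γ z₀ / V γ y := (div_pos (hV0 _ _) (hV0 _ _)).le
    rw [e1, abs_mul, abs_of_nonneg h2]
    calc _ ≤ ρ ^ 2 * (L * dist x x') := by
          gcongr
          exact hkL x x' y
      _ ≤ _ := by
          have : 0 ≤ ρ ^ 3 * dist x x' := by positivity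
          linarith
  obtain ⟨σ, hσi, hσ, hσb⟩ := exists_uniform_deviation_bound hA hZ hind he hμ hn hF
    (fun x γ γ' h => by simp only [F, hVS h]) (M := 2 * (ρ ^ 3 + ρ ^ 2 * L)) (by positivity) hFb hFL hm
  refine ⟨σ, hσi, fun ω => (abs_nonneg _).trans (hσ z₀ ω), fun x ω => ?_, hσb⟩
  refine le_of_eq_of_le ?_ (hσ x ω)
  simp only [F, batchMean, ← Finset.mul_sum, mul_div_assoc]

/-- The relative error of the scalings satisfies, in expectation, a linear recursion. -/
lemma exists_ratio_bound [Nonempty E] {A : ℕ} (hA : GeometricCovering E A)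
    (hZ : ∀ i, Measurable (Z i)) (hind : iIndepFun Z P)
    {α β : Measure E} [IsProbabilityMeasure α] [IsProbabilityMeasure β]
    (hα : ∀ i, P.map (Z (.inl i)) = α) (hβ : ∀ i, P.map (Z (.inr i)) = β)
    {k : E → E → ℝ} {ρ L : ℝ} (hρ : 1 ≤ ρ) (hL : 0 ≤ L) (hk : ∀ x y, k x y ∈ Set.Icc ρ⁻¹ ρ)
    (hkc : Continuous (Function.uncurry k)) (hkL : ∀ x x' y, |k x y - k x' y| ≤ L * dist x x')
    (hkL' : ∀ x y y', |k x y - k x y'| ≤ L * dist y y')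
    {w w' : E → ℝ} (hw : ∀ z, w z ∈ Set.Icc ρ⁻¹ ρ) (hw' : ∀ z, w' z ∈ Set.Icc ρ⁻¹ ρ)
    (hwm : Measurable w) (hwm' : Measurable w') (hwi : ∀ x, w x = ∫ y, k x y / w' y ∂β)
    (hwi' : ∀ y, w' y = ∫ x, k x y / w x ∂α)
    {η : ℕ → ℝ} {n₀ : ℕ} {B : ℕ → ℕ} (hη : ∀ t, 1 ≤ t → 0 < η t ∧ η t ≤ 1) (hη1 : η 1 = 1)
    (hB : ∀ t, 1 ≤ t → 1 ≤ B t) (hn : 1 ≤ n₀) {r : ℕ → ℝ} (hr0 : ρ ^ 4 ≤ r 0)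
    (hr : ∀ t, (1 - (ρ ^ 3)⁻¹ / ρ ^ 6 * η (t + 1)) * r t + η (t + 1) * (4 * ρ ^ 24 *
      (2 * (ρ ^ 3 + ρ ^ 2 * L) * (7 * Real.log (4 * A) + 2)) * (Real.sqrt (B (t + 1)))⁻¹)
        ≤ r (t + 1)) (t : ℕ) :
    ∃ θ : Ω → ℝ, Integrable θ P ∧ (∀ ω, 0 ≤ θ ω) ∧
      (∀ ω, RatioLE (fun z => (scalings k η n₀ B (fun i => Z (.inl i) ω)
        (fun i => Z (.inr i) ω) t).1 z / w z) (1 + θ ω)) ∧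
      (∀ ω, RatioLE (fun z => (scalings k η n₀ B (fun i => Z (.inl i) ω)
        (fun i => Z (.inr i) ω) t).2 z / w' z) (1 + θ ω)) ∧
      ∫ ω, θ ω ∂P ≤ r t := by
  have hρ0 : 0 < ρ := by linarith
  have pos := fun γ : ℕ ⊕ ℕ → E => scalings_pos_and_ratioLE
      (fun i => γ (.inl i)) (fun i => γ (.inr i)) hρ hk hη hB hn
  have cont := continuous_scalings (E := E) hρ hk hkc hη hB hn
  have hw0 : ∀ z, 0 < w z := fun z => (inv_pos.2 hρ0).trans_le (hw z).1
  have hw0' : ∀ z, 0 < w' z := fun z => (inv_pos.2 hρ0).trans_le (hw' z).1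
  have hwr : RatioLE w (ρ ^ 2) := ratioLE_of_bounds hρ hw
  have hwr' : RatioLE w' (ρ ^ 2) := ratioLE_of_bounds hρ hw'
  have hww : ∀ z z', w z * w' z' ≤ ρ ^ 2 := fun z z' => by
    rw [pow_two]
    exact mul_le_mul (hw z).2 (hw' z').2 (hw0' z').le hρ0.le
  have hww' : ∀ z z', w' z * w z' ≤ ρ ^ 2 := fun z z' => by
    rw [mul_comm]
    exact hww z' z
  obtain ⟨z₀⟩ := ‹Nonempty E›
  have hne : Nonempty E := ⟨z₀⟩
  induction t with
  | zero =>
    refine ⟨fun _ => ρ ^ 4, integrable_const _, fun _ => by positivity, fun ω => ?_, fun ω => ?_,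
      by simpa using hr0⟩
    · obtain ⟨⟨u0, ur⟩, -⟩ := pos (fun j => Z j ω) 0
      refine (ur.div hwr u0 hw0).mono (fun z => (div_pos (u0 z) (hw0 z)).le) ?_
      nlinarith
    · obtain ⟨-, v0, vr⟩ := pos (fun j => Z j ω) 0
      refine (vr.div hwr' v0 hw0').mono (fun z => (div_pos (v0 z) (hw0' z)).le) ?_
      nlinarith
  | succ t ih =>
    obtain ⟨θ, hθi, hθ0, hθu, hθv, hθr⟩ := ih
    obtain ⟨e0, e1⟩ := hη (t + 1) (by omega)
    have hb := hB (t + 1) (by omega)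
    set n := sampleCount n₀ B t with hn'
    set n' := sampleCount n₀ B (t + 1) with hn''
    set κ : ℝ := 2 * (ρ ^ 3 + ρ ^ 2 * L) * (7 * Real.log (4 * A) + 2) with hκ
    let V : (ℕ ⊕ ℕ → E) → E → ℝ := fun γ =>
      (scalings k η n₀ B (fun i => γ (.inl i)) (fun i => γ (.inr i)) t).2
    let U : (ℕ ⊕ ℕ → E) → E → ℝ := fun γ =>
      (scalings k η n₀ B (fun i => γ (.inl i)) (fun i => γ (.inr i)) (t + 1)).1
    obtain ⟨σ, hσi, hσ0, hσ, hσb⟩ := exists_batchMean_deviation_bound hA hZ hind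
      Sum.inr_injective hβ (S := (Finset.range n).disjSum (Finset.range n)) (n := n)
      (fun i hi => by simpa using hi) hρ hL hk hkc hkL (V := V) (cont t).2
      (fun γ => (pos γ t).2.1) (fun γ => (pos γ t).2.2)
      (fun γ γ' h => by
        simp only [V]
        rw [scalings_congr (fun i hi => h (.inl i) (by simpa using hi))
          (fun i hi => h (.inr i) (by simpa using hi))]) z₀ hb
    -- Here the past contains the current `y` batch, through `U`, but only the `x` samples before
    -- `n`.
    obtain ⟨σ', hσi', hσ0', hσ', hσb'⟩ := exists_batchMean_deviation_bound hA hZ hind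
      Sum.inl_injective hα (S := (Finset.range n).disjSum (Finset.range n')) (n := n)
      (fun i hi => by simpa using hi) (k := fun y x => k x y) hρ hL (fun y x => hk x y)
      (hkc.comp continuous_swap) (fun y y' x => hkL' x y y') (V := U) (cont (t + 1)).1
      (fun γ => (pos γ (t + 1)).1.1) (fun γ => (pos γ (t + 1)).1.2)
      (fun γ γ' h => by
        simp only [U]
        exact scalings_fst_succ_congr (fun i hi => h (.inl i) (by simpa using hi))
          (fun i hi => h (.inr i) (by simpa using hi))) z₀ hb
    set c : ℝ := (ρ ^ 3)⁻¹ / ρ ^ 6 with hc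
    have hc1 : c ≤ 1 := (div_le_one (by positivity)).2
      ((inv_le_one_of_one_le₀ (one_le_pow₀ hρ)).trans (one_le_pow₀ hρ))
    have hc0 : 0 ≤ c := by positivity
    have hcη : 0 ≤ 1 - c * η (t + 1) := by nlinarith
    have hdiv0 : ∀ (ω : Ω), 0 ≤ (1 - c * η (t + 1)) * θ ω := fun ω => mul_nonneg hcη (hθ0 ω)
    have eU : ∀ ω z, U (fun j => Z j ω) z = (1 - η (t + 1)) * (scalings k η n₀ B
        (fun i => Z (.inl i) ω) (fun i => Z (.inr i) ω) t).1 z + η (t + 1) *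
        batchMean (k z) (V fun j => Z j ω) (fun i => Z (.inr i) ω) n (B (t + 1)) := fun ω z => by
      simp only [U, V, scalings, hn']
    have eV : ∀ ω z, (scalings k η n₀ B
        (fun i => Z (.inl i) ω) (fun i => Z (.inr i) ω) (t + 1)).2 z = (1 - η (t + 1)) *
        (scalings k η n₀ B (fun i => Z (.inl i) ω) (fun i => Z (.inr i) ω) t).2 z + η (t + 1) *
        batchMean (fun x => k x z) (U fun j => Z j ω) (fun i => Z (.inl i) ω) n (B (t + 1)) :=
      fun ω z => by simp only [U, scalings, hn']
    have prod := fun ω => scalings_mul_mem (fun i => Z (.inl i) ω) (fun i => Z (.inr i) ω)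
      hρ hk hη hη1 hB hn t
    have hVm : ∀ ω, Measurable (V fun j => Z j ω) := fun ω =>
      Continuous.measurable ((cont t).2.comp (Continuous.prodMk_right fun j => Z j ω))
    have hUm : ∀ ω, Measurable (U fun j => Z j ω) := fun ω =>
      Continuous.measurable ((cont (t + 1)).1.comp (Continuous.prodMk_right fun j => Z j ω))
    have hσσi : Integrable (fun ω => σ ω + σ' ω) P := hσi.add hσi'
    have stepU : ∀ ω, RatioLE (fun z => U (fun j => Z j ω) z / w z)
        (1 + ((1 - c * η (t + 1)) * θ ω + η (t + 1) * (2 * ρ ^ 18 * σ ω))) := by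
      intro ω
      obtain ⟨-, v0, vr⟩ := pos (fun j => Z j ω) t
      have h := RatioLE.halfStep (μ := β) (k := k) (η := η (t + 1)) (τ := 0) hρ hk
        (fun x => (hkc.comp (continuous_const.prodMk continuous_id)).measurable) hw0 hw0' hww hwm'
        hwi hwr hwr' v0 (hVm ω)
        ⟨e0.le, e1⟩ (v0 z₀) (fun z => vr _ _) (fun z => vr _ _)
        (fun z => mul_batchMean_mem hb fun y =>
          mul_div_mem_Icc hρ (hk z y) (v0 _) (v0 _) (vr _ _) (vr _ _))
        (fun z => by rw [← eU ω z]; exact (prod ω).1 z z₀) (hσ0 ω) (fun z => hσ z ω)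
        (hθ0 ω) le_rfl (hθu ω) (by simpa using hθv ω)
      have h' : RatioLE (fun z => U (fun j => Z j ω) z / w z)
          (1 + ((1 - (ρ ^ 3)⁻¹ / ρ ^ 6 * η (t + 1)) * θ ω
            + η (t + 1) * (ρ ^ 6 * (0 + 2 * ρ ^ 12 * σ ω)))) := by
        simp only [eU]
        exact h
      refine h'.mono (fun z => (div_pos ((pos (fun j => Z j ω) (t + 1)).1.1 z) (hw0 z)).le)
        (le_of_eq ?_)
      ring
    have stepU' : ∀ ω, RatioLE (fun z => U (fun j => Z j ω) z / w z)
        (1 + (θ ω + 2 * ρ ^ 18 * σ ω)) := fun ω => by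
      refine (stepU ω).mono
        (fun z => (div_pos ((pos (fun j => Z j ω) (t + 1)).1.1 z) (hw0 z)).le) ?_
      have h1 : c * η (t + 1) * θ ω ≥ 0 := mul_nonneg (mul_nonneg hc0 e0.le) (hθ0 ω)
      have h2 : η (t + 1) * (2 * ρ ^ 18 * σ ω) ≤ 2 * ρ ^ 18 * σ ω :=
        mul_le_of_le_one_left (mul_nonneg (by positivity) (hσ0 ω)) e1
      linarith
    have stepV : ∀ ω, RatioLE (fun z => (scalings k η n₀ B
        (fun i => Z (.inl i) ω) (fun i => Z (.inr i) ω) (t + 1)).2 z / w' z)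
        (1 + ((1 - c * η (t + 1)) * θ ω + η (t + 1) *
          (ρ ^ 6 * (2 * ρ ^ 18 * σ ω + 2 * ρ ^ 12 * σ' ω)))) := by
      intro ω
      obtain ⟨⟨u0, ur⟩, -⟩ := pos (fun j => Z j ω) (t + 1)
      -- The second update uses the first scaling already updated, whose error is bounded by `θ + 2
      -- ρ ^ 18 σ` instead of `θ`; the excess is `τ`, and it explains the final power `ρ ^ 24`.
      have h := RatioLE.halfStep (μ := α) (k := fun y x => k x y) (η := η (t + 1))
        (τ := 2 * ρ ^ 18 * σ ω) hρ (fun y x => hk x y)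
        (fun y => (hkc.comp (continuous_id.prodMk continuous_const)).measurable) hw0' hw0 hww' hwm
        hwi' hwr' hwr u0 (hUm ω)
        ⟨e0.le, e1⟩ (u0 z₀) (fun z => ur _ _) (fun z => ur _ _)
        (fun z => mul_batchMean_mem hb fun x =>
          mul_div_mem_Icc hρ (hk x z) (u0 _) (u0 _) (ur _ _) (ur _ _))
        (fun z => by
          have := (prod ω).2 z₀ z
          rw [eV ω z] at this
          exact this) (hσ0' ω) (fun z => hσ' z ω)
        (hθ0 ω) (mul_nonneg (by positivity) (hσ0 ω)) (hθv ω) (stepU' ω)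
      simp only [eV]
      exact h
    have hnew : Integrable (fun ω => (1 - c * η (t + 1)) * θ ω + η (t + 1) *
        (2 * ρ ^ 24 * (σ ω + σ' ω))) P :=
      (hθi.const_mul _).add ((hσσi.const_mul _).const_mul _)
    have hσσ : ∀ ω, 0 ≤ σ ω + σ' ω := fun ω => add_nonneg (hσ0 ω) (hσ0' ω)
    have q1 : ρ ^ 18 ≤ ρ ^ 24 := pow_le_pow_right₀ hρ (by norm_num)
    refine ⟨_, hnew, fun ω => ?_, fun ω => ?_, fun ω => ?_, ?_⟩
    · exact add_nonneg (hdiv0 ω) (mul_nonneg e0.le (mul_nonneg (by positivity) (hσσ ω)))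
    · refine (stepU ω).mono
        (fun z => (div_pos ((pos (fun j => Z j ω) (t + 1)).1.1 z) (hw0 z)).le) ?_
      have : 2 * ρ ^ 18 * σ ω ≤ 2 * ρ ^ 24 * (σ ω + σ' ω) :=
        mul_le_mul (by linarith) (by linarith [hσ0' ω]) (hσ0 ω) (by positivity)
      have := mul_le_mul_of_nonneg_left this e0.le
      linarith
    · refine (stepV ω).mono
        (fun z => (div_pos ((pos (fun j => Z j ω) (t + 1)).2.1 z) (hw0' z)).le) ?_
      have h1 : 2 * ρ ^ 18 * σ' ω ≤ 2 * ρ ^ 24 * σ' ω :=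
        mul_le_mul_of_nonneg_right (by linarith) (hσ0' ω)
      have h2 : ρ ^ 6 * (2 * ρ ^ 18 * σ ω + 2 * ρ ^ 12 * σ' ω) ≤ 2 * ρ ^ 24 * (σ ω + σ' ω) := by
        calc _ = 2 * ρ ^ 24 * σ ω + 2 * ρ ^ 18 * σ' ω := by ring
          _ ≤ _ := by linarith
      have := mul_le_mul_of_nonneg_left h2 e0.le
      linarith
    · rw [integral_add (hθi.const_mul _) ((hσσi.const_mul _).const_mul _),
        integral_const_mul, integral_const_mul, integral_const_mul, integral_add hσi hσi']
      refine le_trans ?_ (hr t)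
      have h1 := mul_le_mul_of_nonneg_left hθr hcη
      have h2 : 2 * ρ ^ 24 * (∫ ω, σ ω ∂P + ∫ ω, σ' ω ∂P)
          ≤ 4 * ρ ^ 24 * κ * (Real.sqrt (B (t + 1)))⁻¹ := by
        calc _ ≤ 2 * ρ ^ 24 * (κ * (Real.sqrt (B (t + 1)))⁻¹ + κ * (Real.sqrt (B (t + 1)))⁻¹) := by
              gcongr
          _ = _ := by ring
      have := mul_le_mul_of_nonneg_left h2 e0.le
      linarith

end OnlineSinkhorn
end

/-! ### Solving the recursion, and passing from iterations to samples. -/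

noncomputable section

namespace OnlineSinkhorn

/-- A supersolution of the recursion `r_{t+1} = (1 - c (t + 1) ^ b) r_t + D (t + 1) ^ (b - a)`
that decays like `t ^ (-a)`. -/
lemma exists_supersolution {a b c : ℝ} (D R : ℝ) (ha : 0 < a) (hb : -1 < b) (hb0 : b ≤ 0)
    (hc : 0 < c) (hc1 : c ≤ 1) :
    ∃ K > 0, ∃ r : ℕ → ℝ, R ≤ r 0 ∧
      (∀ t : ℕ, (1 - c * ((t + 1 : ℕ) : ℝ) ^ b) * r t + D * ((t + 1 : ℕ) : ℝ) ^ (b - a)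
        ≤ r (t + 1)) ∧
      ∀ t : ℕ, 1 ≤ t → r t ≤ K * (t : ℝ) ^ (-a) := by
  -- Bernoulli's inequality needs an exponent of at least one.
  set a' : ℝ := max a 1 with ha'
  have ha1 : 1 ≤ a' := le_max_right _ _
  have haa : a ≤ a' := le_max_left _ _
  -- One step lowers `(t + s) ^ (-a)` by a relative amount of at most `a' / (t + 1 + s)`. Because `b
  -- > -1`, a large shift makes this at most half of the contraction `c (t + 1) ^ b`; the other half
  -- pays for the noise.
  obtain ⟨s, hs, hs1⟩ : ∃ s : ℝ, 2 * a' / c ≤ s ^ (1 + b) ∧ 1 ≤ s :=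
    (((tendsto_rpow_atTop (by linarith : 0 < 1 + b)).eventually_ge_atTop _).and
      (eventually_ge_atTop 1)).exists
  have hs0 : 0 < s := by linarith
  -- The three entries serve the initial value, the noise and positivity.
  set K : ℝ := max (max (R * s ^ a) (2 * D * (1 + s) ^ a / c)) 1 with hK
  have hK0 : 0 < K := lt_of_lt_of_le one_pos (le_max_right _ _)
  have hK1 : R * s ^ a ≤ K := (le_max_left _ _).trans (le_max_left _ _)
  have hK2 : 2 * D * (1 + s) ^ a / c ≤ K := (le_max_right _ _).trans (le_max_left _ _)
  refine ⟨K, hK0, fun t => K * (t + s) ^ (-a), ?_, fun t => ?_, fun t ht => ?_⟩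
  · have : 0 < s ^ a := by positivity
    simp only [Nat.cast_zero, zero_add, Real.rpow_neg hs0.le]
    rw [← div_eq_mul_inv, le_div_iff₀ this]
    exact hK1
  · set T : ℝ := ((t + 1 : ℕ) : ℝ) with hT
    have hT1 : 1 ≤ T := by rw [hT]; push_cast; linarith [Nat.cast_nonneg (α := ℝ) t]
    have hT0 : 0 < T := by linarith
    set q : ℝ := T + s with hq
    have hq0 : 0 < q := by linarith
    have hq1 : (t : ℝ) + s = q - 1 := by rw [hq, hT]; push_cast; ring
    have hq2 : 0 < q - 1 := by linarith
    change (1 - c * T ^ b) * (K * ((t : ℝ) + s) ^ (-a)) + D * T ^ (b - a) ≤ K * q ^ (-a)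
    rw [hq1]
    have hTb : 0 < T ^ b := by positivity
    have hTb1 : T ^ b ≤ 1 := Real.rpow_le_one_of_one_le_of_nonpos hT1 hb0
    have bern : (1 - a' / q) * (q - 1) ^ (-a) ≤ q ^ (-a) := by
      have h1 : 1 + a' * (-(1 / q)) ≤ (1 + -(1 / q)) ^ a' :=
        one_add_mul_self_le_rpow_one_add
          (by rw [neg_le_neg_iff, div_le_one hq0]; linarith) ha1
      have e : 1 + -(1 / q) = (q - 1) / q := by field_simp; ring
      rw [e] at h1
      have h2 : ((q - 1) / q) ^ a' ≤ ((q - 1) / q) ^ a :=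
        Real.rpow_le_rpow_of_exponent_ge (by positivity)
          ((div_le_one hq0).2 (by linarith)) haa
      have h3 : 1 - a' / q ≤ ((q - 1) / q) ^ a := by
        refine le_trans (le_of_eq ?_) (h1.trans h2)
        ring
      have h4 : 0 < (q - 1) ^ a := by positivity
      have h5 : 0 < q ^ a := by positivity
      calc (1 - a' / q) * (q - 1) ^ (-a) ≤ ((q - 1) / q) ^ a * (q - 1) ^ (-a) := by gcongr
        _ = q ^ (-a) := by
          rw [Real.div_rpow hq2.le hq0.le, Real.rpow_neg hq2.le, Real.rpow_neg hq0.le]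
          field_simp
    have hy : a' / q ≤ c * T ^ b / 2 := by
      have h1 : s ^ (1 + b) ≤ q ^ (1 + b) :=
        Real.rpow_le_rpow hs0.le (by linarith) (by linarith)
      have h2 : q ^ b ≤ T ^ b := Real.rpow_le_rpow_of_nonpos hT0 (by linarith) hb0
      have h3 : q ^ (1 + b) = q * q ^ b := by rw [Real.rpow_add hq0, Real.rpow_one]
      have h4 : 2 * a' / c ≤ q * T ^ b := by
        refine (hs.trans h1).trans ?_
        rw [h3]
        gcongr
      rw [div_le_iff₀ hc] at h4
      rw [div_le_iff₀ hq0]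
      linarith
    have hx1 : c * T ^ b ≤ 1 := mul_le_one₀ hc1 hTb.le hTb1
    have hx0 : 0 < c * T ^ b := by positivity
    have hy0 : 0 ≤ a' / q := by positivity
    set x := c * T ^ b with hx
    set y := a' / q with hy'
    have hA0 : 0 < (q - 1) ^ (-a) := by positivity
    have main : (1 - x) * (q - 1) ^ (-a) ≤ (1 - x / 2) * q ^ (-a) := by
      have h1 : 1 - x ≤ (1 - x / 2) * (1 - y) := by nlinarith
      calc _ ≤ (1 - x / 2) * (1 - y) * (q - 1) ^ (-a) := by gcongr
        _ = (1 - x / 2) * ((1 - y) * (q - 1) ^ (-a)) := by ring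
        _ ≤ _ := by
          have : 0 ≤ 1 - x / 2 := by linarith
          gcongr
    have noise : D * T ^ (b - a) ≤ K * (x / 2 * q ^ (-a)) := by
      have h1 : q ≤ (1 + s) * T := by nlinarith
      have h2 : q ^ a ≤ (1 + s) ^ a * T ^ a := by
        rw [← Real.mul_rpow (by linarith) hT0.le]
        exact Real.rpow_le_rpow hq0.le h1 ha.le
      have hTa : 0 < T ^ a := by positivity
      have hqa : 0 < q ^ a := by positivity
      have h4 : D * q ^ a ≤ K * (c / 2) * T ^ a := by
        rcases le_or_gt D 0 with hD | hD
        · exact (mul_nonpos_of_nonpos_of_nonneg hD hqa.le).trans (by positivity)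
        · calc D * q ^ a ≤ D * ((1 + s) ^ a * T ^ a) := by gcongr
            _ = (2 * D * (1 + s) ^ a / c) * (c / 2) * T ^ a := by field_simp
            _ ≤ _ := by gcongr
      rw [Real.rpow_sub hT0, Real.rpow_neg hq0.le, hx]
      have e1 : D * (T ^ b / T ^ a) = T ^ b * (D * q ^ a) / (T ^ a * q ^ a) := by field_simp
      have e2 : K * (c * T ^ b / 2 * (q ^ a)⁻¹) = T ^ b * (K * (c / 2) * T ^ a) / (T ^ a * q ^ a) := by
        field_simp
      rw [e1, e2]
      gcongr
    have := mul_le_mul_of_nonneg_left main hK0.le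
    linarith
  · have ht0 : (0 : ℝ) < t := by exact_mod_cast ht
    have : ((t : ℝ) + s) ^ (-a) ≤ (t : ℝ) ^ (-a) :=
      Real.rpow_le_rpow_of_nonpos ht0 (by linarith) (by linarith)
    dsimp only
    gcongr

section schedule

variable {B : ℕ → ℕ} {a : ℝ}

lemma rpow_two_mul_eq_sq {x : ℝ} (hx : 0 < x) : x ^ (2 * a) = (x ^ a) ^ 2 := by
  rw [two_mul, Real.rpow_add hx, sq]

lemma one_le_of_abs_sub_lt (ha : 0 < a) {t : ℕ} (ht : 1 ≤ t)
    (hB : |(B t : ℝ) - (t : ℝ) ^ (2 * a)| < 1) : 1 ≤ B t := by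
  have h1 : (1 : ℝ) ≤ (t : ℝ) ^ (2 * a) :=
    Real.one_le_rpow (by exact_mod_cast ht) (by linarith)
  have h2 := (abs_lt.1 hB).1
  have : (0 : ℝ) < B t := by linarith
  exact_mod_cast this

lemma inv_sqrt_le_of_abs_sub_lt (ha : 0 < a) {t : ℕ} (ht : 1 ≤ t)
    (hB : |(B t : ℝ) - (t : ℝ) ^ (2 * a)| < 1) :
    (Real.sqrt (B t))⁻¹ ≤ 2 * (t : ℝ) ^ (-a) := by
  have ht0 : (0 : ℝ) < t := by exact_mod_cast ht
  have hB1 : (1 : ℝ) ≤ B t := by exact_mod_cast one_le_of_abs_sub_lt ha ht hB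
  have h2 := (abs_lt.1 hB).1
  have hta : 0 < (t : ℝ) ^ a := by positivity
  rw [rpow_two_mul_eq_sq ht0] at h2
  have h3 : (t : ℝ) ^ a / 2 ≤ Real.sqrt (B t) := by
    refine Real.le_sqrt_of_sq_le ?_
    rw [div_pow]
    linarith
  calc (Real.sqrt (B t))⁻¹ ≤ ((t : ℝ) ^ a / 2)⁻¹ := inv_anti₀ (by positivity) h3
    _ = _ := by rw [Real.rpow_neg ht0.le, inv_div, div_eq_mul_inv]

lemma iterationOf_spec (hB : ∀ t, 1 ≤ t → 1 ≤ B t) (N : ℕ) :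
    N < ∑ i ∈ Finset.Icc 1 (iterationOf B N), B i := by
  refine Nat.sInf_mem (s := {t : ℕ | N < ∑ i ∈ Finset.Icc 1 t, B i}) ⟨N + 1, ?_⟩
  have h := Finset.card_nsmul_le_sum (Finset.Icc 1 (N + 1)) (fun i => B i) 1
    (fun i hi => hB i (Finset.mem_Icc.1 hi).1)
  have hN : N + 1 ≤ ∑ i ∈ Finset.Icc 1 (N + 1), B i := by simpa using h
  exact hN

lemma one_le_iterationOf (hB : ∀ t, 1 ≤ t → 1 ≤ B t) (N : ℕ) : 1 ≤ iterationOf B N := by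
  have h := iterationOf_spec hB N
  by_contra h0
  have : iterationOf B N = 0 := by omega
  simp [this] at h

/-- Batches up to iteration `t` have size at most `2 t ^ (2a)`, so `N ≤ 2 t ^ (2a + 1)` at `t =
t(N)`. Raising this to the power `-a / (2a + 1)`, which lies in `[-1, 0]`, costs a factor of at most
`2`. -/
lemma iterationOf_rpow_le (ha : 0 < a)
    (hB : ∀ t : ℕ, 1 ≤ t → |(B t : ℝ) - (t : ℝ) ^ (2 * a)| < 1) {N : ℕ} (hN : 1 ≤ N) :
    (iterationOf B N : ℝ) ^ (-a) ≤ 2 * (N : ℝ) ^ (-a / (2 * a + 1)) := by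
  have hB1 : ∀ t, 1 ≤ t → 1 ≤ B t := fun t ht => one_le_of_abs_sub_lt ha ht (hB t ht)
  set t := iterationOf B N with ht
  have ht1 : (1 : ℝ) ≤ t := by exact_mod_cast one_le_iterationOf hB1 N
  have ht0 : (0 : ℝ) < t := by linarith
  have hN0 : (0 : ℝ) < N := by exact_mod_cast hN
  have h1 : (N : ℝ) ≤ 2 * (t : ℝ) ^ (2 * a + 1) := by
    have h := iterationOf_spec hB1 N
    rw [← ht] at h
    calc (N : ℝ) ≤ ((∑ i ∈ Finset.Icc 1 t, B i : ℕ) : ℝ) := by exact_mod_cast h.le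
      _ = ∑ i ∈ Finset.Icc 1 t, (B i : ℝ) := by push_cast; rfl
      _ ≤ ∑ i ∈ Finset.Icc 1 t, 2 * (t : ℝ) ^ (2 * a) := by
          refine Finset.sum_le_sum fun i hi => ?_
          obtain ⟨hi1, hi2⟩ := Finset.mem_Icc.1 hi
          have hi1' : (1 : ℝ) ≤ i := by exact_mod_cast hi1
          have hi2' : (i : ℝ) ≤ t := by exact_mod_cast hi2
          have e1 := (abs_lt.1 (hB i hi1)).2
          have e2 : (1 : ℝ) ≤ (t : ℝ) ^ (2 * a) := Real.one_le_rpow ht1 (by linarith)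
          have e3 : (i : ℝ) ^ (2 * a) ≤ (t : ℝ) ^ (2 * a) :=
            Real.rpow_le_rpow (by linarith) hi2' (by linarith)
          linarith
      _ = 2 * (t : ℝ) ^ (2 * a + 1) := by
          rw [Real.rpow_add ht0, Real.rpow_one]
          simp
          ring
  have ha2 : 0 < 2 * a + 1 := by linarith
  set p : ℝ := -a / (2 * a + 1) with hp
  have hp0 : p ≤ 0 := div_nonpos_of_nonpos_of_nonneg (by linarith) ha2.le
  have hp1 : -1 ≤ p := by rw [hp, le_div_iff₀ ha2]; linarith
  have e : (t : ℝ) ^ (-a) = ((t : ℝ) ^ (2 * a + 1)) ^ p := by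
    rw [← Real.rpow_mul ht0.le, hp, mul_div_cancel₀ _ ha2.ne']
  rw [e]
  calc ((t : ℝ) ^ (2 * a + 1)) ^ p ≤ ((N : ℝ) / 2) ^ p :=
        Real.rpow_le_rpow_of_nonpos (by positivity) (by linarith) hp0
    _ = (2 : ℝ) ^ (-p) * (N : ℝ) ^ p := by
        rw [Real.div_rpow hN0.le (by norm_num), Real.rpow_neg (by norm_num)]
        ring
    _ ≤ (2 : ℝ) ^ (1 : ℝ) * (N : ℝ) ^ p := by
        gcongr
        · norm_num
        · linarith
    _ = _ := by rw [Real.rpow_one]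

end schedule

lemma exp_neg_rpow_add_rpow_isBigO {c γ p : ℝ} (hc : 0 < c) (hγ : 0 < γ) :
    (fun N : ℕ => Real.exp (-c * (N : ℝ) ^ γ) + (N : ℝ) ^ p) =O[atTop]
      fun N : ℕ => (N : ℝ) ^ p := by
  refine Asymptotics.IsBigO.add ?_ (Asymptotics.isBigO_refl _ _)
  have h1 : Tendsto (fun N : ℕ => (N : ℝ) ^ γ) atTop atTop :=
    (tendsto_rpow_atTop hγ).comp tendsto_natCast_atTop_atTop
  have h2 := ((isLittleO_exp_neg_mul_rpow_atTop hc (p / γ)).comp_tendsto h1).isBigO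
  refine h2.congr_right fun N => ?_
  simp only [Function.comp_apply]
  rw [← Real.rpow_mul (Nat.cast_nonneg N), mul_div_cancel₀ _ hγ.ne']

end OnlineSinkhorn
end

/-! ### From scalings back to potentials. -/

noncomputable section

namespace OnlineSinkhorn

lemma abs_exp_sub_exp_le {s t D : ℝ} (hs : s ≤ D) (ht : t ≤ D) :
    |Real.exp s - Real.exp t| ≤ Real.exp D * |s - t| := by
  have key : ∀ {s t : ℝ}, s ≤ D → Real.exp s - Real.exp t ≤ Real.exp D * |s - t| := by
    intro s t hs
    have h1 := Real.add_one_le_exp (t - s)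
    have h2 : Real.exp t = Real.exp s * Real.exp (t - s) := by rw [← Real.exp_add]; ring_nf
    have h3 := mul_le_mul_of_nonneg_left h1 (Real.exp_pos s).le
    calc Real.exp s - Real.exp t ≤ Real.exp s * (s - t) := by rw [h2]; linarith
      _ ≤ Real.exp s * |s - t| := mul_le_mul_of_nonneg_left (le_abs_self _) (Real.exp_pos s).le
      _ ≤ _ := mul_le_mul_of_nonneg_right (Real.exp_le_exp.2 hs) (abs_nonneg _)
  refine abs_sub_le_iff.2 ⟨key hs, ?_⟩
  rw [abs_sub_comm]
  exact key ht

/-- The soft `C`-transform in terms of the scaling `exp (-f / ε)`. -/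
lemma exp_neg_softTransform {E : Type*} [MeasurableSpace E] {μ : Measure E} [IsProbabilityMeasure μ]
    {ε : ℝ} (hε : 0 < ε) {C : E → E → ℝ} {h : E → ℝ} {x : E}
    (hi : Integrable (fun y => Real.exp ((h y - C x y) / ε)) μ) :
    Real.exp (-softTransform ε C μ h x / ε)
      = ∫ y, Real.exp (-C x y / ε) / Real.exp (-h y / ε) ∂μ := by
  have hpos : 0 < ∫ y, Real.exp ((h y - C x y) / ε) ∂μ := integral_exp_pos hi
  rw [softTransform, neg_mul, neg_neg, mul_div_cancel_left₀ _ hε.ne', Real.exp_log hpos]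
  refine integral_congr_ae (Eventually.of_forall fun y => ?_)
  dsimp only
  rw [← Real.exp_sub]
  ring_nf

lemma continuous_varNorm {T E : Type*} [TopologicalSpace T] [TopologicalSpace E] [CompactSpace E]
    {h : T → E → ℝ} (hh : Continuous (Function.uncurry h)) : Continuous fun t => varNorm (h t) := by
  have h1 := isCompact_univ.continuous_sSup (f := h) (K := (Set.univ : Set E)) hh
  have h2 := isCompact_univ.continuous_sInf (f := h) (K := (Set.univ : Set E)) hh
  simp only [Set.image_univ] at h1 h2
  exact h1.sub h2

lemma varNorm_nonneg {E : Type*} [TopologicalSpace E] [CompactSpace E] [Nonempty E] {h : E → ℝ}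
    (hh : Continuous h) : 0 ≤ varNorm h :=
  varNorm_nonneg_of_bounded (isCompact_range hh).bddAbove (isCompact_range hh).bddBelow

/-- The expected error of online Sinkhorn is at most twice a solution of the recursive
inequality of `exists_ratio_bound`. -/
lemma integral_potentialError_le {Ω : Type*} [MeasurableSpace Ω] {P : Measure Ω}
    [IsProbabilityMeasure P] {E : Type*} [PseudoMetricSpace E] [CompactSpace E]
    [MeasurableSpace E] [BorelSpace E] [Nonempty E] {ε : ℝ} (hε : 0 < ε) {C : E → E → ℝ}
    {A : ℕ} (hA : GeometricCovering E A) {x y : ℕ → Ω → E}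
    (hx : ∀ i, Measurable (x i)) (hy : ∀ i, Measurable (y i)) (hind : iIndepFun (Sum.elim x y) P)
    {α β : Measure E} [IsProbabilityMeasure α] [IsProbabilityMeasure β]
    (hα : ∀ i, P.map (x i) = α) (hβ : ∀ i, P.map (y i) = β)
    {ρ L : ℝ} (hρ : 1 ≤ ρ) (hL : 0 ≤ L) {f g : C(E, ℝ)}
    {k : E → E → ℝ} (hkC : ∀ x y, k x y = Real.exp (-C x y / ε)) {w w' : E → ℝ}
    (hwf : ∀ z, w z = Real.exp (-f z / ε)) (hwg : ∀ z, w' z = Real.exp (-g z / ε))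
    (hk : ∀ x y, k x y ∈ Set.Icc ρ⁻¹ ρ) (hkc : Continuous (Function.uncurry k))
    (hkL : ∀ x x' y, |k x y - k x' y| ≤ L * dist x x')
    (hkL' : ∀ x y y', |k x y - k x y'| ≤ L * dist y y')
    (hw : ∀ z, w z ∈ Set.Icc ρ⁻¹ ρ) (hw' : ∀ z, w' z ∈ Set.Icc ρ⁻¹ ρ)
    (hwi : ∀ x, w x = ∫ y, k x y / w' y ∂β) (hwi' : ∀ y, w' y = ∫ x, k x y / w x ∂α)
    {η : ℕ → ℝ} {n₀ : ℕ} {B : ℕ → ℕ} (hη : ∀ t, 1 ≤ t → 0 < η t ∧ η t ≤ 1) (hη1 : η 1 = 1)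
    (hB : ∀ t, 1 ≤ t → 1 ≤ B t) (hn : 1 ≤ n₀) {r : ℕ → ℝ} (hr0 : ρ ^ 4 ≤ r 0)
    (hr : ∀ t, (1 - (ρ ^ 3)⁻¹ / ρ ^ 6 * η (t + 1)) * r t + η (t + 1) * (4 * ρ ^ 24 *
      (2 * (ρ ^ 3 + ρ ^ 2 * L) * (7 * Real.log (4 * A) + 2)) * (Real.sqrt (B (t + 1)))⁻¹)
        ≤ r (t + 1)) (t : ℕ) :
    (∀ ω, 0 ≤ potentialError ε C η n₀ B f g (fun i => x i ω) (fun i => y i ω) t) ∧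
      Integrable (fun ω => potentialError ε C η n₀ B f g (fun i => x i ω) (fun i => y i ω) t) P ∧
      ∫ ω, potentialError ε C η n₀ B f g (fun i => x i ω) (fun i => y i ω) t ∂P ≤ 2 * r t := by
  have hwc : Continuous w := by
    rw [funext hwf]
    exact (f.continuous.neg.div_const ε).rexp
  have hwc' : Continuous w' := by
    rw [funext hwg]
    exact (g.continuous.neg.div_const ε).rexp
  have hZ : ∀ i, Measurable (Sum.elim x y i) := by
    rintro (i | i)
    · exact hx i
    · exact hy i
  have pos := fun γ : ℕ ⊕ ℕ → E => scalings_pos_and_ratioLE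
      (fun i => γ (.inl i)) (fun i => γ (.inr i)) hρ hk hη hB hn
  have cont := continuous_scalings hρ hk hkc hη hB hn
  have hw0 : ∀ z, 0 < w z := fun z => (hwf z).symm ▸ Real.exp_pos _
  have hw0' : ∀ z, 0 < w' z := fun z => (hwg z).symm ▸ Real.exp_pos _
  let Φ : (ℕ ⊕ ℕ → E) → E → ℝ := fun γ z => -Real.log
    ((scalings k η n₀ B (fun i => γ (.inl i)) (fun i => γ (.inr i)) t).1 z / w z)
  let Ψ : (ℕ ⊕ ℕ → E) → E → ℝ := fun γ z => -Real.log
    ((scalings k η n₀ B (fun i => γ (.inl i)) (fun i => γ (.inr i)) t).2 z / w' z)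
  have hΦ : Continuous (Function.uncurry Φ) :=
    (((cont t).1.div (hwc.comp continuous_snd) fun p => (hw0 _).ne').log
      fun p => (div_pos ((pos p.1 t).1.1 _) (hw0 _)).ne').neg
  have hΨ : Continuous (Function.uncurry Ψ) :=
    (((cont t).2.div (hwc'.comp continuous_snd) fun p => (hw0' _).ne').log
      fun p => (div_pos ((pos p.1 t).2.1 _) (hw0' _)).ne').neg
  -- In terms of scalings, `(f_t - f) / ε = -log (u_t / w)`, and likewise for `g`.
  have err : ∀ ω, potentialError ε C η n₀ B f g (fun i => x i ω) (fun i => y i ω) t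
      = varNorm (Φ fun j => Sum.elim x y j ω) + varNorm (Ψ fun j => Sum.elim x y j ω) := by
    intro ω
    obtain ⟨s1, s2⟩ := sum_weights_mul_eq_scalings hε (C := C) hkC hρ hk hη
      hB hn (fun i => x i ω) (fun i => y i ω) t
    have p := pos (fun j => Sum.elim x y j ω) t
    simp only [Sum.elim_inl, Sum.elim_inr] at p
    unfold potentialError
    congr 2
    · funext z
      simp only [Φ, hwf, potentialF, weightedPotential, s1, Sum.elim_inl, Sum.elim_inr]
      rw [Real.log_div (p.1.1 z).ne' (Real.exp_pos _).ne', Real.log_exp]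
      field_simp
      ring
    · funext z
      simp only [Ψ, hwg, potentialG, weightedPotential, s2, Sum.elim_inl, Sum.elim_inr]
      rw [Real.log_div (p.2.1 z).ne' (Real.exp_pos _).ne', Real.log_exp]
      field_simp
      ring
  have err0 : ∀ ω, 0 ≤ potentialError ε C η n₀ B f g (fun i => x i ω)
      (fun i => y i ω) t := fun ω => by
    rw [err]
    exact add_nonneg
      (varNorm_nonneg (hΦ.comp (Continuous.prodMk_right fun j => Sum.elim x y j ω)))
      (varNorm_nonneg (hΨ.comp (Continuous.prodMk_right fun j => Sum.elim x y j ω)))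
  have errm : Measurable fun ω => potentialError ε C η n₀ B f g (fun i => x i ω)
      (fun i => y i ω) t := by
    have hc : Measurable fun γ => varNorm (Φ γ) + varNorm (Ψ γ) :=
      ((continuous_varNorm hΦ).add (continuous_varNorm hΨ)).measurable
    have hZm : Measurable fun ω j => Sum.elim x y j ω := measurable_pi_lambda _ hZ
    rw [funext err]
    clear_value Φ Ψ
    exact hc.comp hZm
  obtain ⟨θ, hθi, hθ0, hθu, hθv, hθr⟩ := exists_ratio_bound hA hZ hind hα hβ hρ hL
    hk hkc hkL hkL' hw hw' hwc.measurable hwc'.measurable hwi hwi' hη hη1 hB hn hr0 hr t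
  have hle : ∀ ω, potentialError ε C η n₀ B f g (fun i => x i ω) (fun i => y i ω) t
      ≤ 2 * θ ω := fun ω => by
    have p := pos (fun j => Sum.elim x y j ω) t
    rw [err, two_mul]
    exact add_le_add
      ((hθu ω).varNorm_log_le (fun z => div_pos (p.1.1 z) (hw0 z)) (hθ0 ω))
      ((hθv ω).varNorm_log_le (fun z => div_pos (p.2.1 z) (hw0' z)) (hθ0 ω))
  have hi := (hθi.const_mul 2).mono' errm.aestronglyMeasurable
    (Eventually.of_forall fun ω => by
      rw [Real.norm_of_nonneg (err0 ω)]
      exact hle ω)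
  refine ⟨err0, hi, (integral_mono hi (hθi.const_mul 2) hle).trans ?_⟩
  rw [integral_const_mul]
  gcongr

end OnlineSinkhorn
end

/-! ### Choice of constants and conclusion. -/

open OnlineSinkhorn in
theorem theorem1 (d : ℕ) (X : Set (EuclideanSpace ℝ (Fin d))) (hX : IsCompact X)
    (α β : Measure X) [IsProbabilityMeasure α] [IsProbabilityMeasure β]
    (C : X → X → ℝ) (L : ℝ≥0) (hC : LipschitzWith L (fun z : X × X => C z.1 z.2))
    (ε : ℝ) (hε : 0 < ε) (fstar gstar : C(X, ℝ))
    (hopt : OnlineSinkhorn.IsOptimalPair ε C α β fstar gstar)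
    (a b : ℝ) (hb : -1 < b) (hb' : b < -1 / 2) (hab : 1 < a - b) :
    ∃ c > 0, ∃ K > 0,
      (fun N : ℕ => Real.exp (-c * (N : ℝ) ^ ((b + 1) / (2 * a + 1)))
          + (N : ℝ) ^ (-a / (2 * a + 1)))
        =O[atTop] (fun N : ℕ => (N : ℝ) ^ (-a / (2 * a + 1))) ∧
      ∀ (Ω : Type*) [MeasurableSpace Ω] (P : Measure Ω) [IsProbabilityMeasure P]
        (x y : ℕ → Ω → X),
        (∀ i, Measurable (x i)) → (∀ i, Measurable (y i)) →
        (∀ i, P.map (x i) = α) → (∀ i, P.map (y i) = β) →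
        iIndepFun (Sum.elim x y) P →
        ∀ (η : ℕ → ℝ) (B : ℕ → ℕ) (n₀ : ℕ),
          (∀ t : ℕ, 1 ≤ t → η t = (t : ℝ) ^ b) →
          (∀ t : ℕ, 1 ≤ t → |(B t : ℝ) - (t : ℝ) ^ (2 * a)| < 1) →
          1 ≤ n₀ →
          (∀ N : ℕ, 1 ≤ N →
            Integrable (fun ω => OnlineSinkhorn.potentialError ε C η n₀ B fstar gstar
              (fun i => x i ω) (fun i => y i ω) (OnlineSinkhorn.iterationOf B N)) P ∧
            ∫ ω, OnlineSinkhorn.potentialError ε C η n₀ B fstar gstar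
                (fun i => x i ω) (fun i => y i ω) (OnlineSinkhorn.iterationOf B N) ∂P
              ≤ K * (Real.exp (-c * (N : ℝ) ^ ((b + 1) / (2 * a + 1)))
                  + (N : ℝ) ^ (-a / (2 * a + 1)))) ∧
          (fun N : ℕ => ∫ ω, OnlineSinkhorn.potentialError ε C η n₀ B fstar gstar
                (fun i => x i ω) (fun i => y i ω) (OnlineSinkhorn.iterationOf B N) ∂P)
            =O[atTop] (fun N : ℕ => (N : ℝ) ^ (-a / (2 * a + 1))) := by
  have ha : 0 < a := by linarith
  have : CompactSpace X := isCompact_iff_compactSpace.1 hX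
  have : Nonempty X := nonempty_of_isProbabilityMeasure α
  obtain ⟨A, hA⟩ := exists_geometricCovering hX
  have hCc : Continuous fun z : X × X => C z.1 z.2 := hC.continuous
  let Cc : C(X × X, ℝ) := ⟨_, hCc⟩
  -- One constant bounds `C / ε` and both potentials over `ε`, so a single `ρ = exp D` controls `k`,
  -- `w` and `w'`.
  set D : ℝ := (‖fstar‖ + ‖gstar‖ + ‖Cc‖) / ε with hD
  have hD0 : 0 ≤ D := by positivity
  have bound : ∀ s : ℝ, |s| ≤ ‖fstar‖ + ‖gstar‖ + ‖Cc‖ → -D ≤ -s / ε ∧ -s / ε ≤ D := by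
    intro s hs
    obtain ⟨h1, h2⟩ := abs_le.1 hs
    rw [hD, ← neg_div]
    constructor <;> gcongr
    linarith
  have bexp : ∀ s : ℝ, |s| ≤ ‖fstar‖ + ‖gstar‖ + ‖Cc‖ →
      Real.exp (-s / ε) ∈ Set.Icc (Real.exp D)⁻¹ (Real.exp D) := by
    intro s hs
    obtain ⟨h1, h2⟩ := bound s hs
    rw [← Real.exp_neg]
    exact ⟨Real.exp_le_exp.2 h1, Real.exp_le_exp.2 h2⟩
  have nf := norm_nonneg fstar
  have ng := norm_nonneg gstar
  have nC := norm_nonneg Cc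
  have bC : ∀ x y, |C x y| ≤ ‖fstar‖ + ‖gstar‖ + ‖Cc‖ := fun x y => by
    have : |C x y| ≤ ‖Cc‖ := Cc.norm_coe_le_norm (x, y)
    linarith
  have bf : ∀ x, |fstar x| ≤ ‖fstar‖ + ‖gstar‖ + ‖Cc‖ := fun x => by
    have : |fstar x| ≤ ‖fstar‖ := fstar.norm_coe_le_norm x
    linarith
  have bg : ∀ x, |gstar x| ≤ ‖fstar‖ + ‖gstar‖ + ‖Cc‖ := fun x => by
    have : |gstar x| ≤ ‖gstar‖ := gstar.norm_coe_le_norm x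
    linarith
  set ρ : ℝ := Real.exp D with hρD
  have hρ : 1 ≤ ρ := Real.one_le_exp hD0
  let k : X → X → ℝ := fun x y => Real.exp (-C x y / ε)
  let w : X → ℝ := fun x => Real.exp (-fstar x / ε)
  let w' : X → ℝ := fun y => Real.exp (-gstar y / ε)
  have hk : ∀ x y, k x y ∈ Set.Icc ρ⁻¹ ρ := fun x y => bexp _ (bC x y)
  have hkc : Continuous (Function.uncurry k) := (hCc.neg.div_const ε).rexp
  have hw : ∀ z, w z ∈ Set.Icc ρ⁻¹ ρ := fun z => bexp _ (bf z)
  have hw' : ∀ z, w' z ∈ Set.Icc ρ⁻¹ ρ := fun z => bexp _ (bg z)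
  have hint : ∀ (μ : Measure X) [IsProbabilityMeasure μ] (f : X → ℝ), Continuous f →
      Integrable f μ := fun μ _ f hf => by
    simpa using hf.continuousOn.integrableOn_compact (μ := μ) isCompact_univ
  have hwi : ∀ x, w x = ∫ y, k x y / w' y ∂β := fun x => by
    simp only [w]
    rw [hopt.eq_left x]
    refine exp_neg_softTransform hε (hint β _ ?_)
    exact ((gstar.continuous.sub (hCc.comp (Continuous.prodMk_right x))).div_const ε).rexp
  have hwi' : ∀ y, w' y = ∫ x, k x y / w x ∂α := fun y => by
    simp only [w']
    rw [hopt.eq_right y]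
    refine exp_neg_softTransform (C := fun y x => C x y) hε (hint α _ ?_)
    exact ((fstar.continuous.sub (hCc.comp (Continuous.prodMk_left y))).div_const ε).rexp
  set Lk : ℝ := ρ * (L / ε) with hLk
  have hLk0 : 0 ≤ Lk := by positivity
  have kLip : ∀ p q : X × X, |k p.1 p.2 - k q.1 q.2| ≤ Lk * dist p q := fun p q => by
    have h1 : |C p.1 p.2 - C q.1 q.2| ≤ L * dist p q := hC.dist_le_mul p q
    refine (abs_exp_sub_exp_le (bound _ (bC _ _)).2 (bound _ (bC _ _)).2).trans ?_
    rw [← sub_div, abs_div, abs_of_pos hε, hLk, mul_assoc,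
      show -C p.1 p.2 - -C q.1 q.2 = -(C p.1 p.2 - C q.1 q.2) by ring, abs_neg, div_mul_eq_mul_div]
    gcongr
  have hkL : ∀ x x' y, |k x y - k x' y| ≤ Lk * dist x x' := fun x x' y => by
    simpa [Prod.dist_eq] using kLip (x, y) (x', y)
  have hkL' : ∀ x y y', |k x y - k x y'| ≤ Lk * dist y y' := fun x y y' => by
    simpa [Prod.dist_eq] using kLip (x, y) (x, y')
  have hlogA : 0 ≤ Real.log (4 * A) := by
    have : (1 : ℝ) ≤ A := by exact_mod_cast hA.1
    exact Real.log_nonneg (by linarith)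
  set M : ℝ := 4 * ρ ^ 24 * (2 * (ρ ^ 3 + ρ ^ 2 * Lk) * (7 * Real.log (4 * A) + 2)) with hM
  have hM0 : 0 ≤ M := by positivity
  set c₀ : ℝ := (ρ ^ 3)⁻¹ / ρ ^ 6 with hc₀
  have hc₀1 : c₀ ≤ 1 := (div_le_one (by positivity)).2
    ((inv_le_one_of_one_le₀ (one_le_pow₀ hρ)).trans (one_le_pow₀ hρ))
  -- The factor `2` comes from the rounding of the batch sizes, and `ρ ^ 4` bounds the initial
  -- ratios. `K` is fixed before the probability space and `n₀` are introduced.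
  obtain ⟨K, hK, r, hr0, hr, hrK⟩ := exists_supersolution (c := c₀) (M * 2) (ρ ^ 4) ha hb
    (by linarith) (by positivity) hc₀1
  have hexp0 : 0 < (b + 1) / (2 * a + 1) := div_pos (by linarith) (by linarith)
  -- The power of `N` alone bounds the error and the exponential is a nonnegative addition, so any
  -- `c > 0` would do. In `4 * K` one factor `2` counts the two potentials, the other is lost from
  -- `t(N)` to `N`.
  refine ⟨1, one_pos, 4 * K, by positivity, exp_neg_rpow_add_rpow_isBigO one_pos hexp0, ?_⟩
  intro Ω _ P _ x y hx hy hxα hyβ hind η B n₀ hη hB hn₀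
  have hB1 : ∀ t, 1 ≤ t → 1 ≤ B t := fun t ht => one_le_of_abs_sub_lt ha ht (hB t ht)
  have hη01 : ∀ t, 1 ≤ t → 0 < η t ∧ η t ≤ 1 := fun t ht => by
    have ht1 : (1 : ℝ) ≤ t := by exact_mod_cast ht
    rw [hη t ht]
    exact ⟨by positivity, Real.rpow_le_one_of_one_le_of_nonpos ht1 (by linarith)⟩
  have hη1 : η 1 = 1 := by simp [hη 1 le_rfl]
  have hrB : ∀ t, (1 - c₀ * η (t + 1)) * r t + η (t + 1) * (M * (Real.sqrt (B (t + 1)))⁻¹)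
      ≤ r (t + 1) := fun t => by
    refine le_trans ?_ (hr t)
    have ht0 : (0 : ℝ) < ((t + 1 : ℕ) : ℝ) := by positivity
    rw [hη _ (by omega), sub_eq_add_neg b a, Real.rpow_add ht0]
    have h := inv_sqrt_le_of_abs_sub_lt ha (by omega) (hB (t + 1) (by omega))
    have h1 := mul_le_mul_of_nonneg_left (mul_le_mul_of_nonneg_left h hM0)
      (Real.rpow_nonneg ht0.le b)
    linarith
  have main : ∀ t, 1 ≤ t → (∀ ω, 0 ≤ potentialError ε C η n₀ B fstar gstar (fun i => x i ω)
      (fun i => y i ω) t) ∧ Integrable (fun ω => potentialError ε C η n₀ B fstar gstar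
        (fun i => x i ω) (fun i => y i ω) t) P ∧
      ∫ ω, potentialError ε C η n₀ B fstar gstar (fun i => x i ω) (fun i => y i ω) t ∂P
        ≤ 2 * (K * (t : ℝ) ^ (-a)) := fun t ht => by
    obtain ⟨h1, h2, h3⟩ := integral_potentialError_le hε hA hx hy hind hxα hyβ hρ hLk0
      (k := k) (fun _ _ => rfl) (w := w) (w' := w') (fun _ => rfl) (fun _ => rfl)
      hk hkc hkL hkL' hw hw' hwi hwi' hη01 hη1 hB1 hn₀ hr0 hrB t
    exact ⟨h1, h2, h3.trans (by linarith [hrK t ht])⟩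
  have rate : ∀ N : ℕ, 1 ≤ N → ∫ ω, potentialError ε C η n₀ B fstar gstar (fun i => x i ω)
      (fun i => y i ω) (iterationOf B N) ∂P ≤ 4 * K * (N : ℝ) ^ (-a / (2 * a + 1)) := fun N hN => by
    refine (main _ (one_le_iterationOf hB1 N)).2.2.trans ?_
    have := mul_le_mul_of_nonneg_left (iterationOf_rpow_le ha hB hN) hK.le
    linarith
  refine ⟨fun N hN => ⟨(main _ (one_le_iterationOf hB1 N)).2.1, (rate N hN).trans ?_⟩, ?_⟩
  · gcongr
    exact le_add_of_nonneg_left (Real.exp_pos _).le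
  · refine Asymptotics.IsBigO.of_bound (4 * K) ?_
    filter_upwards [eventually_ge_atTop 1] with N hN
    rw [Real.norm_of_nonneg (integral_nonneg (main _ (one_le_iterationOf hB1 N)).1),
      Real.norm_of_nonneg (Real.rpow_nonneg (Nat.cast_nonneg N) _)]
    exact rate N hN
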